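/- **Setting.** Let $s_0=s_1=s_2<s_3<\dots<s_m=s_{m+1}=s_{m+2}$ and $t_0=t_1=t_2<t_3<\dots<t_n=t_{n+1}=t_{n+2}$ be knot sequences ($m,n\ge 3$), let $N_i(s)$ $(0\le i<m)$ and $N_j(t)$ $(0\le j<n)$ be the quadratic B-splines they define, let $\Omega^p=(s_2,s_m)\times(t_2,t_n)$, and let $h$ be the largest length of a knot span in either direction. The elements are the closed boxes $\omega_{i,j}=[s_i,s_{i+1}]\times[t_j,t_{j+1}]$, $2\le i<m$, $2\le j<n$. With $\tau_i^k=\frac{s_{i+k}+s_{i+k+1}}2$, $\tau_i=\frac{s_{i+2}-s_{i+1}}{s_{i+2}-s_i}$ and $$\alpha_{i,0}=-\frac{\tau_i^2(1-\tau_{i+1})}{1+\tau_i-\tau_{i+1}},\quad \alpha_{i,1}=1+\tau_i(1-\tau_{i+1}),\quad \alpha_{i,2}=-\frac{(1-\tau_{i+1})^2\tau_i}{1+\tau_i-\tau_{i+1}}$$ (where $0/0=0$), and with $\sigma_j^l$, $\beta_{j,l}$ defined in the same way from the knots $t_j$, the quadratic quasi-interpolant of $g$ is $I_bg=\sum_{i,j}\mu_{i,j}(g)N_i(s)N_j(t)$,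 $\mu_{i,j}(g)=\sum_{k,l=0}^{2}\alpha_{i,k}\beta_{j,l}\,g(\tau_i^k,\sigma_j^l)$. Let $\Omega_0^p,\Omega_1^p$ be disjoint open sets with $\overline{\Omega^p}=\overline{\Omega_0^p}\cup\overline{\Omega_1^p}$, and let $\Gamma=\overline{\Omega_0^p}\cap\overline{\Omega_1^p}$ be the interface. Let $\mathcal J^f_0$ be the set of elements that meet $\Gamma$, let $\mathcal J^f_1$ consist of $\mathcal J^f_0$ and all elements that have a vertex in common with an element of $\mathcal J^f_0$, and let $\mathcal J^f_{1,+}$ (the enriched elements) be the set of elements in $\mathcal J^f_1$ that meet $\Omega_0^p$. Let $f$ be continuous on $\overline{\Omega^p}$ with $f|_{\Omega^p_r}\in W^{3,\infty}(\Omega^p_r)$ for $r=0,1$. Let $\bar f_0,\bar f_1$ be continuous on $\overline{\Omega^p}$ with $$\bar f_r=f\ \text{ on }\Omega_r^p,\qquad \|\bar f_r\|_{W^{3,\infty}(\Omega^p)}\le E\,\|f\|_{W^{3,\infty}(\Omega^p_r)},\qquad r=0,1 .$$ Here $\|\cdot\|_{W^{3,\infty}}$ is the maximum of the $L^\infty$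 norms of all weak derivatives of order at most $3$. The modified quasi-interpolant is $I_b^*f=\sum_{i,j}c_{i,j}N_i(s)N_j(t)$, where $c_{i,j}=\mu_{i,j}(\bar f_0)$ if the middle box $[s_{i+1},s_{i+2}]\times[t_{j+1},t_{j+2}]$ of the support of $N_i(s)N_j(t)$ is contained in $\overline{\Omega_0^p}\setminus\Gamma$, and $c_{i,j}=\mu_{i,j}(\bar f_1)$ otherwise. (Thus $I_b^*f=I_b\bar f_0$ on the elements that meet $\Omega_0^p$ and are not in $\mathcal J^f_{1,+}$, and $I_b^*f=I_b\bar f_1$ on the elements contained in $\overline{\Omega_1^p}$.) **Theorem.** There is an absolute constant $0<C<1$ such that, for all such knot sequences, $\Omega_0^p$, $\Omega_1^p$, $E\ge 0$, $f$, $\bar f_0$, $\bar f_1$, $$\|f-I_b^*f\|_{L^\infty\left(\Omega^p\setminus\bigcup_{\omega\in\mathcal J^f_{1,+}}\omega\right)}\le C\,E\,h^3\,\max_{r=0,1}\|f\|_{W^{3,\infty}(\Omega_r^p)} .$$ -/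

import Mathlib

open Set MeasureTheory
open scoped ENNReal NNReal

noncomputable section

namespace SplineInterface

/-! ## Sobolev norms `W^{k,∞}` on open subsets of the plane -/

/-- The classical mixed partial derivative `∂^{a+b} φ / ∂s^a ∂t^b`. -/
def mixedPartial (a b : ℕ) (φ : ℝ × ℝ → ℝ) (z : ℝ × ℝ) : ℝ :=
  iteratedDeriv a (fun x => iteratedDeriv b (fun y => φ (x, y)) z.2) z.1

/-- `g` is the weak derivative `∂_s^a ∂_t^b f` on the open set `U`. -/
def IsWeakDeriv (U : Set (ℝ × ℝ)) (a b : ℕ) (f g : ℝ × ℝ → ℝ) : Prop :=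
  LocallyIntegrableOn f U volume ∧ LocallyIntegrableOn g U volume ∧
    ∀ φ : ℝ × ℝ → ℝ, ContDiff ℝ ((⊤ : ℕ∞) : WithTop ℕ∞) φ → HasCompactSupport φ → tsupport φ ⊆ U →
      ∫ z in U, f z * mixedPartial a b φ z = (-1) ^ (a + b) * ∫ z in U, g z * φ z

/-- The `L^∞(U)` norm of the weak derivative `∂_s^a ∂_t^b f`; it is `∞` if there is no such weak
derivative, and any two weak derivatives agree almost everywhere on `U`. -/
def weakDerivNorm (U : Set (ℝ × ℝ)) (a b : ℕ) (f : ℝ × ℝ → ℝ) : ℝ≥0∞ :=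
  ⨅ (g : ℝ × ℝ → ℝ) (_ : IsWeakDeriv U a b f g), eLpNorm g ∞ (volume.restrict U)

/-- The norm of `W^{k,∞}(U)`: the maximum of the `L^∞(U)` norms of all weak derivatives of order
at most `k`. -/
def sobolevNorm (k : ℕ) (U : Set (ℝ × ℝ)) (f : ℝ × ℝ → ℝ) : ℝ≥0∞ :=
  ⨆ (a : ℕ) (b : ℕ) (_ : a + b ≤ k), weakDerivNorm U a b f

/-- Membership in `W^{k,∞}(U)`. -/
def MemSobolev (k : ℕ) (U : Set (ℝ × ℝ)) (f : ℝ × ℝ → ℝ) : Prop :=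
  sobolevNorm k U f < ∞

/-! ## Quadratic B-splines and their quasi-interpolation -/

/-- A knot sequence `s_0, …, s_{m+2}` for `m` quadratic B-splines: the first three knots coincide,
the last three knots coincide, and the interior knots are simple. The values `knot i` with
`i > m + 2` play no role. -/
structure KnotSeq (m : ℕ) where
  knot : ℕ → ℝ
  three_le : 3 ≤ m
  first : knot 0 = knot 1 ∧ knot 1 = knot 2
  last : knot m = knot (m + 1) ∧ knot (m + 1) = knot (m + 2)
  strict : ∀ i, 2 ≤ i → i < m → knot i < knot (i + 1)

/-- The B-spline `N_j^d`, by the recursion formula with the convention `0 / 0 = 0`. -/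
def bspline (s : ℕ → ℝ) : ℕ → ℕ → ℝ → ℝ
  | 0, j, x => if s j ≤ x ∧ x < s (j + 1) then 1 else 0
  | d + 1, j, x =>
      (x - s j) / (s (j + d + 1) - s j) * bspline s d j x +
        (s (j + d + 2) - x) / (s (j + d + 2) - s (j + 1)) * bspline s d (j + 1) x

/-- The sampling points `τ_j^k = (s_{j+k} + s_{j+k+1}) / 2`. -/
def node (s : ℕ → ℝ) (j : ℕ) (k : Fin 3) : ℝ := (s (j + k) + s (j + k + 1)) / 2

/-- The ratios `τ_j = (s_{j+2} - s_{j+1}) / (s_{j+2} - s_j)` (with `0 / 0 = 0`). -/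
def ratio (s : ℕ → ℝ) (j : ℕ) : ℝ := (s (j + 2) - s (j + 1)) / (s (j + 2) - s j)

/-- The weights `α_{j,k}` (with `0 / 0 = 0`). -/
def weight (s : ℕ → ℝ) (j : ℕ) : Fin 3 → ℝ :=
  ![-(ratio s j ^ 2 * (1 - ratio s (j + 1)) / (1 + ratio s j - ratio s (j + 1))),
    1 + ratio s j * (1 - ratio s (j + 1)),
    -((1 - ratio s (j + 1)) ^ 2 * ratio s j / (1 + ratio s j - ratio s (j + 1)))]

variable {m n : ℕ}

/-- The tensor-product coefficient functional `μ_{i,j}`. -/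
def coeff (S : KnotSeq m) (T : KnotSeq n) (g : ℝ × ℝ → ℝ) (i j : ℕ) : ℝ :=
  ∑ k : Fin 3, ∑ l : Fin 3,
    weight S.knot i k * weight T.knot j l * g (node S.knot i k, node T.knot j l)

/-- The quasi-interpolant `I_b g = ∑ μ_{i,j}(g) N_i(s) N_j(t)`. -/
def quasiInterp (S : KnotSeq m) (T : KnotSeq n) (g : ℝ × ℝ → ℝ) (z : ℝ × ℝ) : ℝ :=
  ∑ i ∈ Finset.range m, ∑ j ∈ Finset.range n,
    coeff S T g i j * (bspline S.knot 2 i z.1 * bspline T.knot 2 j z.2)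

/-! ## The mesh -/

/-- The (open) parameter domain `Ω^p`. -/
def paramDomain (S : KnotSeq m) (T : KnotSeq n) : Set (ℝ × ℝ) :=
  Ioo (S.knot 2) (S.knot m) ×ˢ Ioo (T.knot 2) (T.knot n)

/-- The step size: the largest length of a knot span in either direction. -/
def stepSize (S : KnotSeq m) (T : KnotSeq n) : ℝ :=
  max (⨆ i : Fin (m + 2), (S.knot (i + 1) - S.knot i))
    (⨆ j : Fin (n + 2), (T.knot (j + 1) - T.knot j))

/-- The closed box `[s_i, s_{i+1}] × [t_j, t_{j+1}]`. -/
def box (S : KnotSeq m) (T : KnotSeq n) (e : ℕ × ℕ) : Set (ℝ × ℝ) :=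
  Icc (S.knot e.1) (S.knot (e.1 + 1)) ×ˢ Icc (T.knot e.2) (T.knot (e.2 + 1))

/-- The four vertices of a box. -/
def vertices (S : KnotSeq m) (T : KnotSeq n) (e : ℕ × ℕ) : Set (ℝ × ℝ) :=
  {S.knot e.1, S.knot (e.1 + 1)} ×ˢ {T.knot e.2, T.knot (e.2 + 1)}

/-- The indices of the elements of the mesh: the boxes of positive area. -/
def elementIdx (m n : ℕ) : Set (ℕ × ℕ) := Ico 2 m ×ˢ Ico 2 n

/-! ## The interface and the enriched elements -/

/-- `Ω` is divided into the two disjoint open parts `Ω₀` and `Ω₁`. -/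
structure IsDivision (Ω Ω₀ Ω₁ : Set (ℝ × ℝ)) : Prop where
  open_zero : IsOpen Ω₀
  open_one : IsOpen Ω₁
  disjoint : Disjoint Ω₀ Ω₁
  cover : closure Ω = closure Ω₀ ∪ closure Ω₁

/-- The interface `Γ`. -/
def interface (Ω₀ Ω₁ : Set (ℝ × ℝ)) : Set (ℝ × ℝ) := closure Ω₀ ∩ closure Ω₁

/-- `J_k^f`: the elements that meet the interface (`k = 0`), successively enlarged `k` times by all
elements that have a vertex in common with an element already present. -/
def nearIdx (S : KnotSeq m) (T : KnotSeq n) (Ω₀ Ω₁ : Set (ℝ × ℝ)) : ℕ → Set (ℕ × ℕ)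
  | 0 => {e ∈ elementIdx m n | (box S T e ∩ interface Ω₀ Ω₁).Nonempty}
  | k + 1 => {e ∈ elementIdx m n | e ∈ nearIdx S T Ω₀ Ω₁ k ∨
      ∃ e' ∈ nearIdx S T Ω₀ Ω₁ k, (vertices S T e ∩ vertices S T e').Nonempty}

/-- `J_{k,+}^f`: the elements in `J_k^f` that meet `Ω₀`. -/
def nearIdxPlus (S : KnotSeq m) (T : KnotSeq n) (Ω₀ Ω₁ : Set (ℝ × ℝ)) (k : ℕ) : Set (ℕ × ℕ) :=
  {e ∈ nearIdx S T Ω₀ Ω₁ k | (box S T e ∩ Ω₀).Nonempty}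

/-- The union of the enriched elements `ω_i`, `i ∈ J_{1,+}^f`. -/
def enrichedRegion (S : KnotSeq m) (T : KnotSeq n) (Ω₀ Ω₁ : Set (ℝ × ℝ)) : Set (ℝ × ℝ) :=
  ⋃ e ∈ nearIdxPlus S T Ω₀ Ω₁ 1, box S T e

/-! ## The modified quasi-interpolant -/

open Classical in
/-- The coefficient of `N_i(s) N_j(t)` in the modified quasi-interpolant. The B-spline
`N_i(s) N_j(t)` corresponds to the middle box `[s_{i+1}, s_{i+2}] × [t_{j+1}, t_{j+2}]` of its
support. If this box lies on the side of `Ω₀` and does not meet the interface, the coefficient is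
computed from the extension `g₀` of the piece on `Ω₀`; otherwise (the box lies on the side of `Ω₁`
or meets the interface) it is computed from the extension `g₁` of the piece on `Ω₁`. -/
def modCoeff (S : KnotSeq m) (T : KnotSeq n) (Ω₀ Ω₁ : Set (ℝ × ℝ)) (g₀ g₁ : ℝ × ℝ → ℝ)
    (i j : ℕ) : ℝ :=
  if box S T (i + 1, j + 1) ⊆ closure Ω₀ \ interface Ω₀ Ω₁ then coeff S T g₀ i j
  else coeff S T g₁ i j

/-- The modified quasi-interpolant `I_b^* f` of a function whose pieces on `Ω₀`, `Ω₁` have been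
extended to `g₀`, `g₁`. See `modQuasiInterp_eq_zero` and `modQuasiInterp_eq_one`: on the elements
outside `J_{1,+}^f` on the side of `Ω₀` it is `I_b g₀`, and on the elements on the side of `Ω₁` it
is `I_b g₁`. -/
def modQuasiInterp (S : KnotSeq m) (T : KnotSeq n) (Ω₀ Ω₁ : Set (ℝ × ℝ))
    (g₀ g₁ : ℝ × ℝ → ℝ) (z : ℝ × ℝ) : ℝ :=
  ∑ i ∈ Finset.range m, ∑ j ∈ Finset.range n,
    modCoeff S T Ω₀ Ω₁ g₀ g₁ i j * (bspline S.knot 2 i z.1 * bspline T.knot 2 j z.2)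

/-- `g` is an extension, continuous on the closure of `Ω` and with the bound
`‖g‖_{W^{3,∞}(Ω)} ≤ E ‖f‖_{W^{3,∞}(Ω')}`, of the restriction of `f` to the part `Ω'` of `Ω`. -/
structure IsExtension (Ω Ω' : Set (ℝ × ℝ)) (E : ℝ≥0) (f g : ℝ × ℝ → ℝ) : Prop where
  continuousOn : ContinuousOn g (closure Ω)
  eqOn : EqOn g f Ω'
  bound : sobolevNorm 3 Ω g ≤ E * sobolevNorm 3 Ω' f

/-! ## The modified quasi-interpolant on single elements -/

theorem KnotSeq.le_succ (S : KnotSeq m) (i : ℕ) (hi : i < m + 2) :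
    S.knot i ≤ S.knot (i + 1) := by
  have h3 := S.three_le
  rcases Nat.lt_or_ge i 2 with h | h
  · interval_cases i
    · exact S.first.1.le
    · exact S.first.2.le
  · rcases Nat.lt_or_ge i m with h' | h'
    · exact (S.strict i h h').le
    · obtain rfl | rfl : i = m ∨ i = m + 1 := by omega
      · exact S.last.1.le
      · exact S.last.2.le

theorem KnotSeq.mono (S : KnotSeq m) {i j : ℕ} (hij : i ≤ j) (hj : j ≤ m + 2) :
    S.knot i ≤ S.knot j := by
  induction j, hij using Nat.le_induction with
  | base => exact le_rfl
  | succ j _ ih => exact (ih (by omega)).trans (S.le_succ j (by omega))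

theorem bspline_support (S : KnotSeq m) (d j : ℕ) (x : ℝ) (hj : j + d + 1 ≤ m + 2)
    (h : bspline S.knot d j x ≠ 0) : S.knot j ≤ x ∧ x < S.knot (j + d + 1) := by
  induction d generalizing j with
  | zero =>
    by_contra hc
    exact h (by simp only [bspline]; exact if_neg hc)
  | succ d ih =>
    by_cases h0 : bspline S.knot d j x = 0
    · by_cases h1 : bspline S.knot d (j + 1) x = 0
      · exact absurd (by simp [bspline, h0, h1]) h
      · obtain ⟨ha, hb⟩ := ih (j + 1) (by omega) h1
        refine ⟨(S.mono (Nat.le_succ j) (by omega)).trans ha, ?_⟩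
        rwa [show j + (d + 1) + 1 = j + 1 + d + 1 by omega]
    · obtain ⟨ha, hb⟩ := ih j (by omega) h0
      exact ⟨ha, hb.trans_le (S.mono (by omega) (by omega))⟩

/-- Only the B-splines `N_{p-2}, N_{p-1}, N_p` are non-zero on the knot span `[s_p, s_{p+1})`. -/
theorem bspline_active (S : KnotSeq m) {i p : ℕ} {x : ℝ} (hi : i < m) (hp : p < m)
    (hx : x ∈ Ico (S.knot p) (S.knot (p + 1))) (h : bspline S.knot 2 i x ≠ 0) :
    i ≤ p ∧ p ≤ i + 2 := by
  obtain ⟨ha, hb⟩ := bspline_support S 2 i x (by omega) h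
  constructor
  · by_contra hc
    exact absurd (hx.2.trans_le ((S.mono (by omega) (by omega)).trans ha)) (lt_irrefl x)
  · by_contra hc
    exact absurd (hb.trans_le ((S.mono (by omega) (by omega)).trans hx.1)) (lt_irrefl x)

/-- The middle knot span of an active B-spline is contained in a knot span `[s_q, s_{q+1}]` of
positive length, and shares an endpoint with the given knot span. -/
theorem middle_span (S : KnotSeq m) {i p : ℕ} (hi : i < m) (hp : p ∈ Ico 2 m)
    (h1 : i ≤ p) (h2 : p ≤ i + 2) :
    ∃ q ∈ Ico 2 m, Icc (S.knot (i + 1)) (S.knot (i + 2)) ⊆ Icc (S.knot q) (S.knot (q + 1)) ∧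
      ∃ v ∈ Icc (S.knot (i + 1)) (S.knot (i + 2)),
        v ∈ ({S.knot p, S.knot (p + 1)} : Set ℝ) ∧ v ∈ ({S.knot q, S.knot (q + 1)} : Set ℝ) := by
  have h3 := S.three_le
  have hle := S.le_succ (i + 1) (by omega)
  obtain ⟨hp1, hp2⟩ := hp
  rcases Nat.eq_zero_or_pos i with rfl | hi0
  · have : p = 2 := by omega
    subst this
    refine ⟨2, ⟨le_rfl, hp2⟩, ?_, S.knot 2, ⟨S.first.2.le, le_rfl⟩, by simp, by simp⟩
    exact Icc_subset_Icc S.first.2.ge (S.le_succ 2 (by omega))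
  rcases Nat.lt_or_ge (i + 1) m with him | him
  · refine ⟨i + 1, ⟨by omega, him⟩, le_rfl, ?_⟩
    obtain rfl | rfl | rfl : p = i ∨ p = i + 1 ∨ p = i + 2 := by omega
    · exact ⟨_, left_mem_Icc.2 hle, by simp, by simp⟩
    · exact ⟨_, left_mem_Icc.2 hle, by simp, by simp⟩
    · exact ⟨_, right_mem_Icc.2 hle, by simp, by simp⟩
  · obtain rfl : m = i + 1 := by omega
    have : p = i := by omega
    subst this
    refine ⟨p, ⟨hp1, hp2⟩, ?_, S.knot (p + 1), left_mem_Icc.2 hle, by simp, by simp⟩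
    exact Icc_subset_Icc (S.le_succ p (by omega)) S.last.1.ge

theorem box_subset_closure (S : KnotSeq m) (T : KnotSeq n) {e : ℕ × ℕ}
    (he : e ∈ elementIdx m n) : box S T e ⊆ closure (paramDomain S T) := by
  obtain ⟨⟨h1, h2⟩, h3, h4⟩ := he
  have hS : S.knot 2 < S.knot m := (S.mono h1 (by omega)).trans_lt
    ((S.strict _ h1 h2).trans_le (S.mono (by omega) (by omega)))
  have hT : T.knot 2 < T.knot n := (T.mono h3 (by omega)).trans_lt
    ((T.strict _ h3 h4).trans_le (T.mono (by omega) (by omega)))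
  rw [paramDomain, closure_prod_eq, closure_Ioo hS.ne, closure_Ioo hT.ne]
  exact prod_mono (Icc_subset_Icc (S.mono h1 (by omega)) (S.mono (by omega) (by omega)))
    (Icc_subset_Icc (T.mono h3 (by omega)) (T.mono (by omega) (by omega)))

theorem vertices_subset_box (S : KnotSeq m) (T : KnotSeq n) {e : ℕ × ℕ}
    (he : e ∈ elementIdx m n) : vertices S T e ⊆ box S T e := by
  obtain ⟨⟨h1, h2⟩, h3, h4⟩ := he
  have hS := (S.strict _ h1 h2).le
  have hT := (T.strict _ h3 h4).le
  refine prod_mono ?_ ?_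
  · rintro x (rfl | rfl)
    exacts [left_mem_Icc.2 hS, right_mem_Icc.2 hS]
  · rintro x (rfl | rfl)
    exacts [left_mem_Icc.2 hT, right_mem_Icc.2 hT]

/-- An element that does not meet the interface and contains a point of one side lies in it. -/
theorem box_subset_side (S : KnotSeq m) (T : KnotSeq n) {Ω₀ Ω₁ : Set (ℝ × ℝ)}
    (hΩ : IsDivision (paramDomain S T) Ω₀ Ω₁) {e : ℕ × ℕ} (he : e ∈ elementIdx m n)
    (hΓ : ¬ (box S T e ∩ interface Ω₀ Ω₁).Nonempty) (h : (box S T e ∩ closure Ω₀).Nonempty) :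
    box S T e ⊆ closure Ω₀ := by
  have hpre : IsPreconnected (box S T e) := isPreconnected_Icc.prod isPreconnected_Icc
  have hcov := (box_subset_closure S T he).trans hΩ.cover.subset
  intro z hz
  rcases hcov hz with h0 | h1
  · exact h0
  · exact absurd (isPreconnected_closed_iff.1 hpre _ _ isClosed_closure isClosed_closure hcov h
      ⟨z, hz, h1⟩) hΓ

/-- On an element on the side of `Ω₀` outside `J_{1,+}^f`, `I_b^* f` is `I_b g₀`. -/
theorem modQuasiInterp_eq_zero (S : KnotSeq m) (T : KnotSeq n) {Ω₀ Ω₁ : Set (ℝ × ℝ)}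
    (hΩ : IsDivision (paramDomain S T) Ω₀ Ω₁) (g₀ g₁ : ℝ × ℝ → ℝ) {e : ℕ × ℕ}
    (he : e ∈ elementIdx m n) (he0 : (box S T e ∩ Ω₀).Nonempty)
    (heJ : e ∉ nearIdxPlus S T Ω₀ Ω₁ 1) {z : ℝ × ℝ}
    (hz1 : z.1 ∈ Ico (S.knot e.1) (S.knot (e.1 + 1)))
    (hz2 : z.2 ∈ Ico (T.knot e.2) (T.knot (e.2 + 1))) :
    modQuasiInterp S T Ω₀ Ω₁ g₀ g₁ z = quasiInterp S T g₀ z := by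
  have heJ1 : e ∉ nearIdx S T Ω₀ Ω₁ 1 := fun h => heJ ⟨h, he0⟩
  have heΓ : ¬ (box S T e ∩ interface Ω₀ Ω₁).Nonempty := fun h => heJ1 ⟨he, Or.inl ⟨he, h⟩⟩
  have hsub : box S T e ⊆ closure Ω₀ :=
    box_subset_side S T hΩ he heΓ (he0.mono (inter_subset_inter_right _ subset_closure))
  refine Finset.sum_congr rfl fun i hi => Finset.sum_congr rfl fun j hj => ?_
  rw [Finset.mem_range] at hi hj
  by_cases hN1 : bspline S.knot 2 i z.1 = 0
  · simp [hN1]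
  by_cases hN2 : bspline T.knot 2 j z.2 = 0
  · simp [hN2]
  obtain ⟨a1, a2⟩ := bspline_active S hi he.1.2 hz1 hN1
  obtain ⟨b1, b2⟩ := bspline_active T hj he.2.2 hz2 hN2
  obtain ⟨q, hq, hqs, v, -, hvp, hvq⟩ := middle_span S hi he.1 a1 a2
  obtain ⟨r, hr, hrs, w, -, hwp, hwr⟩ := middle_span T hj he.2 b1 b2
  have hbox : box S T (i + 1, j + 1) ⊆ box S T (q, r) := prod_mono hqs hrs
  have hqr : (q, r) ∈ elementIdx m n := ⟨hq, hr⟩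
  have hv : (v, w) ∈ vertices S T e := ⟨hvp, hwp⟩
  have hv' : (v, w) ∈ vertices S T (q, r) := ⟨hvq, hwr⟩
  have hΓ : ¬ (box S T (q, r) ∩ interface Ω₀ Ω₁).Nonempty := fun h =>
    heJ1 ⟨he, Or.inr ⟨(q, r), ⟨hqr, h⟩, (v, w), hv, hv'⟩⟩
  have hside : box S T (q, r) ⊆ closure Ω₀ := box_subset_side S T hΩ hqr hΓ
    ⟨(v, w), vertices_subset_box S T hqr hv', hsub (vertices_subset_box S T he hv)⟩
  have hmid : box S T (i + 1, j + 1) ⊆ closure Ω₀ \ interface Ω₀ Ω₁ := fun y hy =>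
    ⟨hside (hbox hy), fun hyΓ => hΓ ⟨y, hbox hy, hyΓ⟩⟩
  rw [modCoeff, if_pos hmid]

/-- On an element on the side of `Ω₁`, `I_b^* f` is `I_b g₁`. -/
theorem modQuasiInterp_eq_one (S : KnotSeq m) (T : KnotSeq n) {Ω₀ Ω₁ : Set (ℝ × ℝ)}
    (g₀ g₁ : ℝ × ℝ → ℝ) {e : ℕ × ℕ}
    (he : e ∈ elementIdx m n) (he1 : box S T e ⊆ closure Ω₁) {z : ℝ × ℝ}
    (hz1 : z.1 ∈ Ico (S.knot e.1) (S.knot (e.1 + 1)))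
    (hz2 : z.2 ∈ Ico (T.knot e.2) (T.knot (e.2 + 1))) :
    modQuasiInterp S T Ω₀ Ω₁ g₀ g₁ z = quasiInterp S T g₁ z := by
  refine Finset.sum_congr rfl fun i hi => Finset.sum_congr rfl fun j hj => ?_
  rw [Finset.mem_range] at hi hj
  by_cases hN1 : bspline S.knot 2 i z.1 = 0
  · simp [hN1]
  by_cases hN2 : bspline T.knot 2 j z.2 = 0
  · simp [hN2]
  obtain ⟨a1, a2⟩ := bspline_active S hi he.1.2 hz1 hN1
  obtain ⟨b1, b2⟩ := bspline_active T hj he.2.2 hz2 hN2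
  obtain ⟨q, hq, hqs, v, hvm, hvp, hvq⟩ := middle_span S hi he.1 a1 a2
  obtain ⟨r, hr, hrs, w, hwm, hwp, hwr⟩ := middle_span T hj he.2 b1 b2
  have hv : (v, w) ∈ box S T e := vertices_subset_box S T he ⟨hvp, hwp⟩
  have hmid : ¬ box S T (i + 1, j + 1) ⊆ closure Ω₀ \ interface Ω₀ Ω₁ := fun h =>
    have hm : (v, w) ∈ box S T (i + 1, j + 1) := ⟨hvm, hwm⟩
    (h hm).2 ⟨(h hm).1, he1 hv⟩
  rw [modCoeff, if_neg hmid]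

end SplineInterface

end

/-!
The estimate is pointwise. A point outside the enriched region lies in an element which either meets
`Ω₀`, and then the modified quasi-interpolant is `I_b g₀` there and `f = g₀` by continuity, or does
not meet `Ω₀`, and then the element lies in the closure of `Ω₁` (`box_subset_closure_one`), the
modified quasi-interpolant is `I_b g₁` and `f = g₁`. It remains to bound `|g - I_b g|` by
`149 / 150 * M * h ^ 3` for a continuous `g` with `W^{3,∞}` norm at most `M`
(`abs_sub_quasiInterp_le`).

This reduces to one variable. If `P` and `Q` are the quasi-interpolation operators in the two
directions, then `I_b = P Q` and `I - P Q = (I - P) + P (I - Q)`. The operator `P` has norm at most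
`3`, so four times the one-dimensional error suffices, and only the pure third derivatives enter.
In one variable the operator reproduces quadratic polynomials on every knot span, so the error at
`x` is, up to sign, the quasi-interpolant of the Taylor remainder at `x`, which is at most `M / 6
* |y - x| ^ 3` at the sampling points `y`. Adding these bounds over the three active B-splines
with their weights gives `149 / 100 * (M / 6) * h ^ 3` for every position of the knots
(`weighted_distance_sum_le`). In terms of the relative position `t` of the point in its span and
of the ratios `u`, `v` of the span to its unions with the two adjacent spans, this is an
inequality for rational functions on the unit cube, which `outer_le` and `inner_le` turn into the
polynomial inequality `outer_add_outer_add_inner_le`.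
The product `4 * (149 / 100) / 6` is `149 / 150 < 1`.

The classical Taylor theorem is available because `g` is a uniform limit, on the closed rectangle,
of smooth functions whose pure third derivatives are bounded by `M` (`exists_smooth_approx`).
-/

noncomputable section

namespace SplineInterface

variable {m n : ℕ}

/-! ### A polynomial inequality -/

/-- The bound, for step size `1`, of the contribution of the left one of the three active B-splines
to the error at the relative position `t` of a knot span. The right one contributes
`outerBound (1 - t) v`. Here `u` is the ratio of the span to its union with the adjacent span on the
same side. -/
def outerBound (t u : ℝ) : ℝ :=
  (1 - t) ^ 2 * (u * (2 - u) * (1 / 2 + t) ^ 3 + u * (1 - u ^ 2) / 2 * (3 / 2 + t) ^ 3 +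
    u * (1 - u) * |t - 1 / 2| ^ 3)

/-- The bound, for step size `1`, of the contribution of the middle one of the three active
B-splines to the error at the relative position `t` of a knot span, not counting the value of the
B-spline itself. -/
def innerBound (t : ℝ) : ℝ :=
  1 / 4 + |t - 1 / 2| / 4 + 2 * |t - 1 / 2| ^ 2 + 5 / 2 * |t - 1 / 2| ^ 3

/-- The polynomial inequality behind `outer_add_outer_add_inner_le`, where `d` is the distance of
the relative position from the midpoint. For `u ≤ 0.54` and for `u ≥ 0.54`, the difference of the two
sides has nonnegative coefficients in the Bernstein basis of degree `5` in `d` and `3` in `u`. -/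
theorem bernstein_bound {d u : ℝ} (hd0 : 0 ≤ d) (hd1 : d ≤ 1 / 2) (hu0 : 0 ≤ u) (hu1 : u ≤ 1) :
    (1 / 2 + d) ^ 2 * (u * (2 - u) * (1 - d) ^ 3 + u * (1 - u ^ 2) / 2 * (2 - d) ^ 3 +
        u * (1 - u) * d ^ 3) +
      (1 / 2 - d) ^ 2 * ((1 + d) ^ 3 + 193 / 1000 * (2 + d) ^ 3 + d ^ 3 / 4) +
      (1 - (1 / 2 + d) ^ 2 * u) * (1 / 4 + d / 4 + 2 * d ^ 2 + 5 / 2 * d ^ 3) ≤ 149 / 100 := by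
  have h2 : 0 ≤ 1 - 2 * d := by linarith
  have key : ∀ a b : ℝ, 0 ≤ a → 0 ≤ b → ∀ i j k l : ℕ,
      0 ≤ d ^ i * (1 - 2 * d) ^ j * (a ^ k * b ^ l) := fun a b ha hb i j k l => by positivity
  -- `K i j k l` is the nonnegativity of one Bernstein polynomial
  rcases le_total u (54 / 100) with h | h
  · have K := key u (54 / 100 - u) hu0 (by linarith)
    linarith [K 0 5 0 3, K 1 4 0 3, K 2 3 0 3, K 3 2 0 3, K 4 1 0 3, K 5 0 0 3,
      K 0 5 1 2, K 1 4 1 2, K 2 3 1 2, K 3 2 1 2, K 4 1 1 2, K 5 0 1 2,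
      K 0 5 2 1, K 1 4 2 1, K 2 3 2 1, K 3 2 2 1, K 4 1 2 1, K 5 0 2 1,
      K 0 5 3 0, K 1 4 3 0, K 2 3 3 0, K 3 2 3 0, K 4 1 3 0, K 5 0 3 0]
  · have K := key (u - 54 / 100) (1 - u) (by linarith) (by linarith)
    linarith [K 0 5 0 3, K 1 4 0 3, K 2 3 0 3, K 3 2 0 3, K 4 1 0 3, K 5 0 0 3,
      K 0 5 1 2, K 1 4 1 2, K 2 3 1 2, K 3 2 1 2, K 4 1 1 2, K 5 0 1 2,
      K 0 5 2 1, K 1 4 2 1, K 2 3 2 1, K 3 2 2 1, K 4 1 2 1, K 5 0 2 1,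
      K 0 5 3 0, K 1 4 3 0, K 2 3 3 0, K 3 2 3 0, K 4 1 3 0, K 5 0 3 0]

theorem outer_add_outer_add_inner_le_half {t u v : ℝ} (ht0 : 0 ≤ t) (ht1 : t ≤ 1 / 2)
    (hu0 : 0 ≤ u) (hu1 : u ≤ 1) (hv0 : 0 ≤ v) (hv1 : v ≤ 1) :
    outerBound t u + outerBound (1 - t) v + (1 - (1 - t) ^ 2 * u - t ^ 2 * v) * innerBound t ≤
      149 / 100 := by
  obtain ⟨d, rfl⟩ : ∃ d, t = 1 / 2 - d := ⟨1 / 2 - t, by ring⟩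
  have hd0 : 0 ≤ d := by linarith
  have hd1 : d ≤ 1 / 2 := by linarith
  have e1 : |1 / 2 - d - 1 / 2| = d := by rw [← abs_neg, abs_of_nonneg] <;> linarith
  have e2 : |1 - (1 / 2 - d) - 1 / 2| = d := by rw [abs_of_nonneg] <;> linarith
  have v1 : v * (2 - v) ≤ 1 := by nlinarith [sq_nonneg (1 - v)]
  -- the cubic `v (1 - v²)` is largest at `1 / √3 ≈ 0.577`
  have v2 : v * (1 - v ^ 2) / 2 ≤ 193 / 1000 := by
    nlinarith [mul_nonneg hv0 (sq_nonneg (v - 577 / 1000)), sq_nonneg (v - 577 / 1000)]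
  have v3 : v * (1 - v) ≤ 1 / 4 := by nlinarith [sq_nonneg (v - 1 / 2)]
  have hv : v * (2 - v) * (1 + d) ^ 3 + v * (1 - v ^ 2) / 2 * (2 + d) ^ 3 + v * (1 - v) * d ^ 3 ≤
      (1 + d) ^ 3 + 193 / 1000 * (2 + d) ^ 3 + d ^ 3 / 4 := by
    have := mul_le_mul_of_nonneg_right v1 (show 0 ≤ (1 + d) ^ 3 by positivity)
    have := mul_le_mul_of_nonneg_right v2 (show 0 ≤ (2 + d) ^ 3 by positivity)
    have := mul_le_mul_of_nonneg_right v3 (show 0 ≤ d ^ 3 by positivity)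
    linarith
  have hv' := mul_le_mul_of_nonneg_left hv (sq_nonneg (1 / 2 - d))
  have hI : 0 ≤ (1 / 2 - d) ^ 2 * v * (1 / 4 + d / 4 + 2 * d ^ 2 + 5 / 2 * d ^ 3) := by positivity
  have B := bernstein_bound hd0 hd1 hu0 hu1
  rw [outerBound, outerBound, innerBound, e1, e2]
  linarith

/-- The total error of the three active B-splines, whose values are `(1 - t)² u`,
`1 - (1 - t)² u - t² v` and `t² v`. The constant only has to be less than `3 / 2`. -/
theorem outer_add_outer_add_inner_le {t u v : ℝ} (ht0 : 0 ≤ t) (ht1 : t ≤ 1)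
    (hu0 : 0 ≤ u) (hu1 : u ≤ 1) (hv0 : 0 ≤ v) (hv1 : v ≤ 1) :
    outerBound t u + outerBound (1 - t) v + (1 - (1 - t) ^ 2 * u - t ^ 2 * v) * innerBound t ≤
      149 / 100 := by
  rcases le_total t (1 / 2) with h | h
  · exact outer_add_outer_add_inner_le_half ht0 h hu0 hu1 hv0 hv1
  · have H := outer_add_outer_add_inner_le_half (t := 1 - t) (by linarith) (by linarith)
      hv0 hv1 hu0 hu1
    have e : innerBound (1 - t) = innerBound t := by
      rw [innerBound, innerBound, show 1 - t - 1 / 2 = -(t - 1 / 2) by ring, abs_neg]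
    rw [e, show 1 - (1 - t) = t by ring] at H
    linarith

/-! ### Weights and weighted distances -/

/-- The three weights of a B-spline in terms of the ratios `P` and `R` of its middle knot span to
the union of the middle span with the left and the right span. -/
def ratioWeight (P R : ℝ) : Fin 3 → ℝ :=
  ![-(P ^ 2 * R / (P + R)), 1 + P * R, -(R ^ 2 * P / (P + R))]

theorem weight_eq_ratioWeight (s : ℕ → ℝ) (j : ℕ) :
    weight s j = ratioWeight (ratio s j) (1 - ratio s (j + 1)) := by
  rw [weight, ratioWeight, show 1 + ratio s j - ratio s (j + 1) = ratio s j + (1 - ratio s (j + 1))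
    by ring]

theorem ratioWeight_swap (P R : ℝ) (k : Fin 3) : ratioWeight R P k = ratioWeight P R (2 - k) := by
  fin_cases k <;> simp [ratioWeight, add_comm, mul_comm]

theorem abs_ratioWeight_zero {P R : ℝ} (hP : 0 ≤ P) (hR : 0 ≤ R) :
    |ratioWeight P R 0| = P ^ 2 * R / (P + R) := by
  simp only [ratioWeight, Matrix.cons_val_zero, abs_neg]
  exact abs_of_nonneg (by positivity)

theorem abs_ratioWeight_one {P R : ℝ} (hP : 0 ≤ P) (hR : 0 ≤ R) :
    |ratioWeight P R 1| = 1 + P * R := by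
  simp only [ratioWeight, Matrix.cons_val_one, Matrix.cons_val_zero]
  exact abs_of_nonneg (by positivity)

theorem abs_ratioWeight_two {P R : ℝ} (hP : 0 ≤ P) (hR : 0 ≤ R) :
    |ratioWeight P R 2| = R ^ 2 * P / (P + R) := by
  simp only [ratioWeight, Matrix.cons_val, abs_neg]
  exact abs_of_nonneg (by positivity)

theorem sum_abs_ratioWeight_le {P R : ℝ} (hP0 : 0 ≤ P) (hP1 : P ≤ 1) (hR0 : 0 ≤ R) (hR1 : R ≤ 1) :
    ∑ k, |ratioWeight P R k| ≤ 3 := by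
  rw [Fin.sum_univ_three, abs_ratioWeight_zero hP0 hR0, abs_ratioWeight_one hP0 hR0,
    abs_ratioWeight_two hP0 hR0]
  have h1 : P ^ 2 * R / (P + R) + R ^ 2 * P / (P + R) ≤ P * R := by
    rw [← add_div]
    exact div_le_of_le_mul₀ (by positivity) (by positivity) (by nlinarith)
  have h2 : P * R ≤ 1 := mul_le_one₀ hP1 hR0 hR1
  linarith

/-- The contribution of the B-spline whose right knot span contains the point, at distances `x`,
`y`, `z` from the sampling points in its left, middle and right span. -/
theorem outer_le {P u h t x y z : ℝ} (hP0 : 0 ≤ P) (hP1 : P ≤ 1) (hu0 : 0 ≤ u) (hu1 : u ≤ 1)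
    (hx0 : 0 ≤ x) (hx : x ≤ h * (3 / 2 + t)) (hy0 : 0 ≤ y) (hy : y ≤ h * (1 / 2 + t))
    (hz0 : 0 ≤ z) (hz : z ≤ h * |t - 1 / 2|) :
    (1 - t) ^ 2 * u * (|ratioWeight P (1 - u) 0| * x ^ 3 + |ratioWeight P (1 - u) 1| * y ^ 3 +
      |ratioWeight P (1 - u) 2| * z ^ 3) ≤ h ^ 3 * outerBound t u := by
  obtain ⟨R, rfl⟩ : ∃ R, u = 1 - R := ⟨1 - u, by ring⟩
  have hR0 : 0 ≤ R := by linarith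
  have hR1 : R ≤ 1 := by linarith
  rw [show 1 - (1 - R) = R by ring, abs_ratioWeight_zero hP0 hR0, abs_ratioWeight_one hP0 hR0,
    abs_ratioWeight_two hP0 hR0]
  have w0 : P ^ 2 * R / (P + R) ≤ R * (2 - R) / 2 := by
    apply div_le_of_le_mul₀ (by positivity) (by nlinarith)
    nlinarith [mul_nonneg hP0 (sub_nonneg.2 hP1),
      mul_nonneg hR0 (add_nonneg (sub_nonneg.2 hP1) (sub_nonneg.2 hR1))]
  have w1 : 1 + P * R ≤ 1 + R := by nlinarith
  have w2 : R ^ 2 * P / (P + R) ≤ R := by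
    apply div_le_of_le_mul₀ (by positivity) hR0
    nlinarith [mul_nonneg hP0 hR0, mul_nonneg (mul_nonneg hP0 hR0) (sub_nonneg.2 hR1)]
  have x3 : x ^ 3 ≤ h ^ 3 * (3 / 2 + t) ^ 3 := by rw [← mul_pow]; gcongr
  have y3 : y ^ 3 ≤ h ^ 3 * (1 / 2 + t) ^ 3 := by rw [← mul_pow]; gcongr
  have z3 : z ^ 3 ≤ h ^ 3 * |t - 1 / 2| ^ 3 := by rw [← mul_pow]; gcongr
  have hx3 : 0 ≤ x ^ 3 := by positivity
  have hy3 : 0 ≤ y ^ 3 := by positivity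
  have hz3 : 0 ≤ z ^ 3 := by positivity
  have b0 := mul_le_mul w0 x3 hx3 (by nlinarith)
  have b1 := mul_le_mul w1 y3 hy3 (by linarith)
  have b2 := mul_le_mul w2 z3 hz3 hR0
  refine (mul_le_mul_of_nonneg_left (add_le_add (add_le_add b0 b1) b2)
    (by positivity)).trans (le_of_eq ?_)
  rw [outerBound]
  ring

/-- The contribution of the B-spline whose middle knot span contains the point, at distances `x`,
`y`, `z` from the sampling points in its left, middle and right span. If the middle span is long
compared to an adjacent one, so that the weights are large, then `hux` and `hvz` improve on `hx` and
`hz`. -/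
theorem inner_le {u v h t x y z : ℝ} (hu0 : 0 < u) (hu1 : u ≤ 1) (hv0 : 0 < v) (hv1 : v ≤ 1)
    (hx0 : 0 ≤ x) (hx : x ≤ h * (1 / 2 + t)) (hux : u * x ≤ h * (1 / 2 + u * (t - 1 / 2)))
    (hy0 : 0 ≤ y) (hy : y ≤ h * |t - 1 / 2|)
    (hz0 : 0 ≤ z) (hz : z ≤ h * (3 / 2 - t)) (hvz : v * z ≤ h * (1 / 2 - v * (t - 1 / 2)))
    (hh : 0 ≤ h) :
    |ratioWeight u v 0| * x ^ 3 + |ratioWeight u v 1| * y ^ 3 + |ratioWeight u v 2| * z ^ 3 ≤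
      h ^ 3 * innerBound t := by
  obtain ⟨e, rfl⟩ : ∃ e, t = 1 / 2 + e := ⟨t - 1 / 2, by ring⟩
  rw [abs_ratioWeight_zero hu0.le hv0.le, abs_ratioWeight_one hu0.le hv0.le,
    abs_ratioWeight_two hu0.le hv0.le, innerBound]
  rw [show (1 / 2 + e - 1 / 2 : ℝ) = e by ring] at *
  rw [show (1 / 2 + (1 / 2 + e) : ℝ) = 1 + e by ring] at hx
  rw [show (3 / 2 - (1 / 2 + e) : ℝ) = 1 - e by ring] at hz
  have hs : 0 < u + v := by linarith
  have huv1 : u * v ≤ 1 := mul_le_one₀ hu1 hv0.le hv1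
  have X : u ^ 2 * x ^ 3 ≤ h ^ 3 * ((1 / 2 + u * e) ^ 2 * (1 + e)) := by
    calc u ^ 2 * x ^ 3 = (u * x) ^ 2 * x := by ring
      _ ≤ (h * (1 / 2 + u * e)) ^ 2 * (h * (1 + e)) := by gcongr
      _ = _ := by ring
  have Z : v ^ 2 * z ^ 3 ≤ h ^ 3 * ((1 / 2 - v * e) ^ 2 * (1 - e)) := by
    calc v ^ 2 * z ^ 3 = (v * z) ^ 2 * z := by ring
      _ ≤ (h * (1 / 2 - v * e)) ^ 2 * (h * (1 - e)) := by gcongr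
      _ = _ := by ring
  have Y : (1 + u * v) * y ^ 3 ≤ h ^ 3 * (2 * |e| ^ 3) := by
    calc (1 + u * v) * y ^ 3 ≤ 2 * (h * |e|) ^ 3 := by gcongr; linarith
      _ = _ := by ring
  have hE : v * ((1 / 2 + u * e) ^ 2 * (1 + e)) + u * ((1 / 2 - v * e) ^ 2 * (1 - e)) ≤
      (1 / 4 + |e| / 4 + 2 * |e| ^ 2 + 1 / 2 * |e| ^ 3) * (u + v) := by
    have he : |e| ^ 2 = e ^ 2 := sq_abs e
    have hdiff : |v - u| ≤ u + v := abs_le.2 ⟨by linarith, by linarith⟩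
    have a1 : e * (v - u) ≤ |e| * (u + v) := by
      refine (le_abs_self _).trans ?_
      rw [abs_mul]
      gcongr
    have a2 : 2 * (u * v) ≤ u + v := by nlinarith
    have a3 : e ^ 3 * (u - v) * (u * v) ≤ |e| ^ 3 * ((u + v) / 2) := by
      refine (le_abs_self _).trans ?_
      rw [abs_mul, abs_mul, abs_pow, abs_of_nonneg (mul_nonneg hu0.le hv0.le), mul_assoc]
      have : |u - v| ≤ 1 := abs_le.2 ⟨by linarith, by linarith⟩
      have h1 : |u - v| * (u * v) ≤ 1 * (u * v) := by gcongr
      gcongr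
      linarith
    have a4 := mul_le_mul_of_nonneg_right a2 (sq_nonneg e)
    have a5 := mul_le_mul_of_nonneg_right huv1 (mul_nonneg (sq_nonneg e) hs.le)
    rw [he]
    linarith
  have hfin : u ^ 2 * v / (u + v) * x ^ 3 + v ^ 2 * u / (u + v) * z ^ 3 ≤
      h ^ 3 * (1 / 4 + |e| / 4 + 2 * |e| ^ 2 + 1 / 2 * |e| ^ 3) := by
    rw [div_mul_eq_mul_div, div_mul_eq_mul_div, ← add_div, div_le_iff₀ hs]
    calc u ^ 2 * v * x ^ 3 + v ^ 2 * u * z ^ 3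
        = v * (u ^ 2 * x ^ 3) + u * (v ^ 2 * z ^ 3) := by ring
      _ ≤ v * (h ^ 3 * ((1 / 2 + u * e) ^ 2 * (1 + e))) +
          u * (h ^ 3 * ((1 / 2 - v * e) ^ 2 * (1 - e))) := by gcongr
      _ = h ^ 3 * (v * ((1 / 2 + u * e) ^ 2 * (1 + e)) + u * ((1 / 2 - v * e) ^ 2 * (1 - e))) := by
          ring
      _ ≤ h ^ 3 * ((1 / 4 + |e| / 4 + 2 * |e| ^ 2 + 1 / 2 * |e| ^ 3) * (u + v)) := by gcongr
      _ = _ := by ring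
  linarith

/-! ### Quasi-interpolation in one variable -/

theorem ratio_nonneg {s : ℕ → ℝ} {i : ℕ} (h1 : s i ≤ s (i + 1)) (h2 : s (i + 1) ≤ s (i + 2)) :
    0 ≤ ratio s i :=
  div_nonneg (by linarith) (by linarith)

theorem ratio_le_one {s : ℕ → ℝ} {i : ℕ} (h1 : s i ≤ s (i + 1)) (h2 : s (i + 1) ≤ s (i + 2)) :
    ratio s i ≤ 1 :=
  div_le_one_of_le₀ (by linarith) (by linarith)

theorem ratio_mul {s : ℕ → ℝ} {i : ℕ} (h1 : s i ≤ s (i + 1)) (h2 : s (i + 1) ≤ s (i + 2)) :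
    ratio s i * (s (i + 2) - s i) = s (i + 2) - s (i + 1) := by
  rcases eq_or_ne (s (i + 2) - s i) 0 with h | h
  · rw [h]
    linarith
  · exact div_mul_cancel₀ _ h

/-- The coefficient functional yields the exact B-spline coefficient of a quadratic polynomial,
which is the value of its polar form at `(s_{i+1}, s_{i+2})`. -/
theorem sum_weight_mul_quadratic {s : ℕ → ℝ} {i : ℕ} (h0 : s i ≤ s (i + 1))
    (h1 : s (i + 1) ≤ s (i + 2)) (h2 : s (i + 2) ≤ s (i + 3)) (x c₀ c₁ c₂ : ℝ) :
    ∑ k, weight s i k * (c₀ + c₁ * (node s i k - x) + c₂ * (node s i k - x) ^ 2) =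
      c₀ + c₁ * ((s (i + 1) + s (i + 2)) / 2 - x) + c₂ * ((s (i + 1) - x) * (s (i + 2) - x)) := by
  have hP := ratio_mul h0 h1
  have hR := ratio_mul (i := i + 1) h1 h2
  have hP0 := ratio_nonneg h0 h1
  have hR1 := ratio_le_one (i := i + 1) h1 h2
  have hw := weight_eq_ratioWeight s i
  simp only [add_assoc, Nat.reduceAdd] at hR hR1
  set P := ratio s i
  obtain ⟨R, hRdef⟩ : ∃ R, 1 - ratio s (i + 1) = R := ⟨_, rfl⟩
  rw [hRdef] at hw
  have hR0 : 0 ≤ R := by linarith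
  have hRe : R * (s (i + 3) - s (i + 1)) = s (i + 2) - s (i + 1) := by
    rw [← hRdef]
    linarith
  rw [hw, Fin.sum_univ_three]
  simp only [ratioWeight, Matrix.cons_val, node, Fin.isValue, Fin.val_zero, Fin.val_one,
    Fin.val_two, add_zero, add_assoc, Nat.reduceAdd]
  obtain ⟨A, hA⟩ : ∃ A, s (i + 2) - s i = A := ⟨_, rfl⟩
  obtain ⟨D, hD⟩ : ∃ D, s (i + 3) - s (i + 1) = D := ⟨_, rfl⟩
  obtain ⟨b, hb⟩ : ∃ b, s (i + 2) - s (i + 1) = b := ⟨_, rfl⟩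
  rw [hA, hb] at hP
  rw [hD, hb] at hRe
  have e1 : s (i + 1) = s (i + 2) - b := by linarith
  have e0 : s i = s (i + 2) - A := by linarith
  have e3 : s (i + 3) = s (i + 2) - b + D := by linarith
  rw [e0, e1, e3]
  generalize s (i + 2) = y
  -- in the degenerate case `P = R = 0`, the two outer weights are `0 / 0 = 0`
  rcases eq_or_ne (P + R) 0 with h | h
  · have hP' : P = 0 := by linarith
    have hb' : b = 0 := by rw [← hP, hP', zero_mul]
    rw [h, hP', hb', div_zero, div_zero]
    ring
  · have hPR : P * R * (A + D) = b * (P + R) := by linear_combination R * hP + P * hRe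
    obtain ⟨a₀, ha₀⟩ : ∃ a, P ^ 2 * R / (P + R) = a := ⟨_, rfl⟩
    obtain ⟨a₂, ha₂⟩ : ∃ a, R ^ 2 * P / (P + R) = a := ⟨_, rfl⟩
    rw [ha₀, ha₂]
    rw [div_eq_iff h] at ha₀ ha₂
    have k1 : a₀ + a₂ = P * R := by
      apply mul_right_cancel₀ h
      linear_combination -ha₀ - ha₂
    have k2 : a₀ * A = a₂ * D := by
      apply mul_right_cancel₀ h
      linear_combination -A * ha₀ + D * ha₂ + P * R * hP - P * R * hRe
    have k3 : a₀ * A ^ 2 + a₂ * D ^ 2 = b ^ 2 := by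
      apply mul_right_cancel₀ h
      linear_combination -A ^ 2 * ha₀ - D ^ 2 * ha₂ + A * P * R * hP + D * P * R * hRe + b * hPR
    linear_combination -(c₀ + c₁ * (y - b / 2 - x) + c₂ * (y - b / 2 - x) ^ 2) * k1 +
      (c₁ / 2 + c₂ * (y - b / 2 - x)) * k2 - c₂ / 4 * k3

/-- The quasi-interpolant of a function of one variable. -/
def quasiInterpOne (S : KnotSeq m) (u : ℝ → ℝ) (x : ℝ) : ℝ :=
  ∑ i ∈ Finset.range m, (∑ k, weight S.knot i k * u (node S.knot i k)) * bspline S.knot 2 i x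

/-- The three quadratic B-splines that are active on a knot span, in terms of the relative
position `t` of the point in the span and of the ratios of the span to its unions with the
adjacent spans. -/
theorem sum_mul_bspline (S : KnotSeq m) (c : ℕ → ℝ) {q : ℕ} (hq : q + 2 < m) {x t u v : ℝ}
    (hx : x ∈ Ico (S.knot (q + 2)) (S.knot (q + 3)))
    (ht : t = (x - S.knot (q + 2)) / (S.knot (q + 3) - S.knot (q + 2)))
    (hu : u = (S.knot (q + 3) - S.knot (q + 2)) / (S.knot (q + 3) - S.knot (q + 1)))
    (hv : v = (S.knot (q + 3) - S.knot (q + 2)) / (S.knot (q + 4) - S.knot (q + 2))) :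
    ∑ i ∈ Finset.range m, c i * bspline S.knot 2 i x =
      c q * ((1 - t) ^ 2 * u) + c (q + 1) * (1 - (1 - t) ^ 2 * u - t ^ 2 * v) +
        c (q + 2) * (t ^ 2 * v) := by
  have h0 := S.le_succ q (by omega)
  have h1 := S.le_succ (q + 1) (by omega)
  have h2 := S.strict (q + 2) (by omega) hq
  have h3 := S.le_succ (q + 3) (by omega)
  have h4 := S.le_succ (q + 4) (by omega)
  simp only [add_assoc, Nat.reduceAdd] at h0 h1 h2 h3 h4
  obtain ⟨hx1, hx2⟩ := hx
  have hsub : ({q, q + 1, q + 2} : Finset ℕ) ⊆ Finset.range m := by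
    intro i hi
    simp only [Finset.mem_insert, Finset.mem_singleton] at hi
    rw [Finset.mem_range]
    omega
  rw [← Finset.sum_subset hsub, Finset.sum_insert (by simp), Finset.sum_insert (by simp),
    Finset.sum_singleton]
  · have b0 : bspline S.knot 0 q x = 0 := if_neg fun h => by linarith [h.2]
    have b1 : bspline S.knot 0 (q + 1) x = 0 := if_neg fun h => by
      have := h.2
      simp only [add_assoc, Nat.reduceAdd] at this
      linarith
    have b2 : bspline S.knot 0 (q + 2) x = 1 := if_pos ⟨hx1, hx2⟩
    have b3 : bspline S.knot 0 (q + 3) x = 0 := if_neg fun h => by linarith [h.1]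
    have b4 : bspline S.knot 0 (q + 4) x = 0 := if_neg fun h => by linarith [h.1]
    have d1 : S.knot (q + 3) - S.knot (q + 1) ≠ 0 := by linarith
    have d2 : S.knot (q + 3) - S.knot (q + 2) ≠ 0 := by linarith
    have d3 : S.knot (q + 4) - S.knot (q + 2) ≠ 0 := by linarith
    have f0 : bspline S.knot 2 q x = (1 - t) ^ 2 * u := by
      simp only [bspline.eq_2, add_assoc, Nat.reduceAdd, add_zero, b0, b1, b2, ht, hu]
      field_simp
      ring
    have f1 : bspline S.knot 2 (q + 1) x = 1 - (1 - t) ^ 2 * u - t ^ 2 * v := by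
      simp only [bspline.eq_2, add_assoc, Nat.reduceAdd, add_zero, b1, b2, b3, ht, hu, hv]
      field_simp
      ring
    have f2 : bspline S.knot 2 (q + 2) x = t ^ 2 * v := by
      simp only [bspline.eq_2, add_assoc, Nat.reduceAdd, add_zero, b2, b3, b4, ht, hv]
      field_simp
      ring
    rw [f0, f1, f2, add_assoc]
  · intro i hi hi'
    by_contra hc
    have hb : bspline S.knot 2 i x ≠ 0 := fun h => hc (by rw [h, mul_zero])
    obtain ⟨ha, hb⟩ := bspline_active S (Finset.mem_range.1 hi) hq ⟨hx1, hx2⟩ hb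
    simp only [Finset.mem_insert, Finset.mem_singleton] at hi'
    omega

theorem node_mem_Icc (S : KnotSeq m) {i : ℕ} (hi : i < m) (k : Fin 3) :
    node S.knot i k ∈ Icc (S.knot 2) (S.knot m) := by
  have hk := k.2
  have h3 := S.three_le
  have h0 := S.first
  have hm := S.last
  have lo : ∀ j, j ≤ m + 2 → S.knot 2 ≤ S.knot j := fun j hj => by
    rw [← h0.2, ← h0.1]
    exact S.mono (Nat.zero_le j) hj
  have hi : ∀ j, j ≤ m + 2 → S.knot j ≤ S.knot m := fun j hj => by
    rw [hm.1, hm.2]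
    exact S.mono hj le_rfl
  have a1 := lo (i + k) (by omega)
  have a2 := lo (i + k + 1) (by omega)
  have b1 := hi (i + k) (by omega)
  have b2 := hi (i + k + 1) (by omega)
  constructor <;> rw [node] <;> linarith

theorem sum_abs_weight_le (S : KnotSeq m) {i : ℕ} (hi : i < m) :
    ∑ k, |weight S.knot i k| ≤ 3 := by
  have h0 := S.le_succ i (by omega)
  have h1 := S.le_succ (i + 1) (by omega)
  have h2 := S.le_succ (i + 2) (by omega)
  have a := ratio_nonneg h0 h1
  have b := ratio_le_one h0 h1
  have c := ratio_nonneg (i := i + 1) h1 h2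
  have d := ratio_le_one (i := i + 1) h1 h2
  rw [weight_eq_ratioWeight]
  exact sum_abs_ratioWeight_le a b (by linarith) (by linarith)

theorem middle_coeff_nonneg {t u v : ℝ} (ht0 : 0 ≤ t) (ht1 : t ≤ 1) (hu1 : u ≤ 1)
    (hv1 : v ≤ 1) : 0 ≤ 1 - (1 - t) ^ 2 * u - t ^ 2 * v := by
  have h1 : (1 - t) ^ 2 * u ≤ (1 - t) ^ 2 := mul_le_of_le_one_right (sq_nonneg _) hu1
  have h2 : t ^ 2 * v ≤ t ^ 2 := mul_le_of_le_one_right (sq_nonneg _) hv1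
  nlinarith

theorem mem_span_coords (S : KnotSeq m) {q : ℕ} (hq : q + 2 < m) {x : ℝ}
    (hx : x ∈ Ico (S.knot (q + 2)) (S.knot (q + 3))) :
    (0 ≤ (x - S.knot (q + 2)) / (S.knot (q + 3) - S.knot (q + 2)) ∧
      (x - S.knot (q + 2)) / (S.knot (q + 3) - S.knot (q + 2)) ≤ 1) ∧
    (0 < (S.knot (q + 3) - S.knot (q + 2)) / (S.knot (q + 3) - S.knot (q + 1)) ∧
      (S.knot (q + 3) - S.knot (q + 2)) / (S.knot (q + 3) - S.knot (q + 1)) ≤ 1) ∧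
    (0 < (S.knot (q + 3) - S.knot (q + 2)) / (S.knot (q + 4) - S.knot (q + 2)) ∧
      (S.knot (q + 3) - S.knot (q + 2)) / (S.knot (q + 4) - S.knot (q + 2)) ≤ 1) := by
  have h1 := S.le_succ (q + 1) (by omega)
  have h2 := S.strict (q + 2) (by omega) hq
  have h3 := S.le_succ (q + 3) (by omega)
  simp only [add_assoc, Nat.reduceAdd] at h1 h2 h3
  obtain ⟨hx1, hx2⟩ := hx
  refine ⟨⟨div_nonneg ?_ ?_, div_le_one_of_le₀ ?_ ?_⟩, ⟨div_pos ?_ ?_, div_le_one_of_le₀ ?_ ?_⟩,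
    ⟨div_pos ?_ ?_, div_le_one_of_le₀ ?_ ?_⟩⟩ <;> linarith

/-- The one-dimensional quasi-interpolant has norm at most `3` in the supremum norm. -/
theorem abs_quasiInterpOne_le (S : KnotSeq m) {p : ℕ} (hp : p ∈ Ico 2 m) {x : ℝ}
    (hx : x ∈ Ico (S.knot p) (S.knot (p + 1))) {w : ℝ → ℝ} {K : ℝ}
    (hw : ∀ y ∈ Icc (S.knot 2) (S.knot m), |w y| ≤ K) :
    |quasiInterpOne S w x| ≤ 3 * K := by
  obtain ⟨q, rfl⟩ : ∃ q, p = q + 2 := ⟨p - 2, by have := hp.1; omega⟩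
  have hq : q + 2 < m := hp.2
  have hK : 0 ≤ K := (abs_nonneg _).trans (hw _ (node_mem_Icc S (i := q) (by omega) 0))
  have hl : ∀ i < m, |∑ k, weight S.knot i k * w (node S.knot i k)| ≤ 3 * K := fun i hi => by
    calc |∑ k, weight S.knot i k * w (node S.knot i k)|
        ≤ ∑ k, |weight S.knot i k * w (node S.knot i k)| := Finset.abs_sum_le_sum_abs _ _
      _ ≤ ∑ k, |weight S.knot i k| * K := Finset.sum_le_sum fun k _ => by
          rw [abs_mul]
          exact mul_le_mul_of_nonneg_left (hw _ (node_mem_Icc S hi k)) (abs_nonneg _)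
      _ ≤ 3 * K := by
          rw [← Finset.sum_mul]
          exact mul_le_mul_of_nonneg_right (sum_abs_weight_le S hi) hK
  obtain ⟨⟨ht0, ht1⟩, ⟨hu0, hu1⟩, ⟨hv0, hv1⟩⟩ := mem_span_coords S hq hx
  rw [quasiInterpOne, sum_mul_bspline S _ hq hx rfl rfl rfl]
  set t := (x - S.knot (q + 2)) / (S.knot (q + 3) - S.knot (q + 2))
  set u := (S.knot (q + 3) - S.knot (q + 2)) / (S.knot (q + 3) - S.knot (q + 1))
  set v := (S.knot (q + 3) - S.knot (q + 2)) / (S.knot (q + 4) - S.knot (q + 2))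
  have n0 : 0 ≤ (1 - t) ^ 2 * u := by positivity
  have n1 := middle_coeff_nonneg ht0 ht1 hu1 hv1
  have n2 : 0 ≤ t ^ 2 * v := by positivity
  have l0 := abs_le.1 (hl q (by omega))
  have l1 := abs_le.1 (hl (q + 1) (by omega))
  have l2 := abs_le.1 (hl (q + 2) (by omega))
  rw [abs_le]
  constructor
  · linarith [mul_le_mul_of_nonneg_right l0.1 n0, mul_le_mul_of_nonneg_right l1.1 n1,
      mul_le_mul_of_nonneg_right l2.1 n2]
  · linarith [mul_le_mul_of_nonneg_right l0.2 n0, mul_le_mul_of_nonneg_right l1.2 n1,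
      mul_le_mul_of_nonneg_right l2.2 n2]

/-- On a knot span, the quasi-interpolant reproduces quadratic polynomials. -/
theorem quasiInterpOne_quadratic (S : KnotSeq m) {q : ℕ} (hq : q + 2 < m) {x : ℝ}
    (hx : x ∈ Ico (S.knot (q + 2)) (S.knot (q + 3))) (c₀ c₁ c₂ : ℝ) :
    quasiInterpOne S (fun y => c₀ + c₁ * (y - x) + c₂ * (y - x) ^ 2) x = c₀ := by
  have h1 := S.le_succ (q + 1) (by omega)
  have h2 := S.strict (q + 2) (by omega) hq
  have h3 := S.le_succ (q + 3) (by omega)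
  rw [quasiInterpOne, Finset.sum_congr rfl fun i hi => by
    rw [sum_weight_mul_quadratic (S.le_succ i (by rw [Finset.mem_range] at hi; omega))
      (S.le_succ (i + 1) (by rw [Finset.mem_range] at hi; omega))
      (S.le_succ (i + 2) (by rw [Finset.mem_range] at hi; omega))],
    sum_mul_bspline S (fun i => c₀ + c₁ * ((S.knot (i + 1) + S.knot (i + 2)) / 2 - x) +
      c₂ * ((S.knot (i + 1) - x) * (S.knot (i + 2) - x))) hq hx rfl rfl rfl]
  simp only [add_assoc, Nat.reduceAdd] at h1 h2 h3 ⊢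
  have d1 : S.knot (q + 3) - S.knot (q + 1) ≠ 0 := by linarith
  have d2 : S.knot (q + 3) - S.knot (q + 2) ≠ 0 := by linarith
  have d3 : S.knot (q + 4) - S.knot (q + 2) ≠ 0 := by linarith
  generalize S.knot (q + 1) = y1 at *
  generalize S.knot (q + 2) = y2 at *
  generalize S.knot (q + 3) = y3 at *
  generalize S.knot (q + 4) = y4 at *
  field_simp
  ring

theorem quasiInterpOne_sub (S : KnotSeq m) (w w' : ℝ → ℝ) (x : ℝ) :
    quasiInterpOne S (fun y => w y - w' y) x = quasiInterpOne S w x - quasiInterpOne S w' x := by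
  simp only [quasiInterpOne, mul_sub, Finset.sum_sub_distrib, sub_mul]

theorem abs_sum_weight_mul_le (S : KnotSeq m) {i : ℕ} (hi : i < m) {w : ℝ → ℝ} {K x : ℝ}
    (hw : ∀ y ∈ Icc (S.knot 2) (S.knot m), |w y| ≤ K * |y - x| ^ 3) :
    |∑ k, weight S.knot i k * w (node S.knot i k)| ≤
      K * ∑ k, |weight S.knot i k| * |node S.knot i k - x| ^ 3 := by
  rw [Finset.mul_sum]
  refine (Finset.abs_sum_le_sum_abs _ _).trans (Finset.sum_le_sum fun k _ => ?_)
  rw [abs_mul, mul_left_comm]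
  exact mul_le_mul_of_nonneg_left (hw _ (node_mem_Icc S hi k)) (abs_nonneg _)

/-- The total weighted third power of the distances between a point of the knot span `[y₂, y₃)` and
the sampling points of the three active B-splines. -/
theorem weighted_distance_sum_le {y0 y1 y2 y3 y4 y5 x t u v h P R : ℝ} (hP0 : 0 ≤ P) (hP1 : P ≤ 1)
    (hR0 : 0 ≤ R) (hR1 : R ≤ 1) (ht0 : 0 ≤ t) (ht1 : t ≤ 1) (hu0 : 0 < u) (hu1 : u ≤ 1)
    (hv0 : 0 < v) (hv1 : v ≤ 1) (g0 : y0 ≤ y1) (g1 : y1 ≤ y2) (g2 : y2 < y3) (g3 : y3 ≤ y4)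
    (g4 : y4 ≤ y5) (k0 : y1 - y0 ≤ h) (k1 : y2 - y1 ≤ h) (k2 : y3 - y2 ≤ h) (k3 : y4 - y3 ≤ h)
    (k4 : y5 - y4 ≤ h) (ht : t * (y3 - y2) = x - y2) (hu : u * (y3 - y1) = y3 - y2)
    (hv : v * (y4 - y2) = y3 - y2) :
    (|ratioWeight P (1 - u) 0| * |(y0 + y1) / 2 - x| ^ 3 +
        |ratioWeight P (1 - u) 1| * |(y1 + y2) / 2 - x| ^ 3 +
        |ratioWeight P (1 - u) 2| * |(y2 + y3) / 2 - x| ^ 3) * ((1 - t) ^ 2 * u) +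
      (|ratioWeight u v 0| * |(y1 + y2) / 2 - x| ^ 3 +
        |ratioWeight u v 1| * |(y2 + y3) / 2 - x| ^ 3 +
        |ratioWeight u v 2| * |(y3 + y4) / 2 - x| ^ 3) * (1 - (1 - t) ^ 2 * u - t ^ 2 * v) +
      (|ratioWeight R (1 - v) 2| * |(y2 + y3) / 2 - x| ^ 3 +
        |ratioWeight R (1 - v) 1| * |(y3 + y4) / 2 - x| ^ 3 +
        |ratioWeight R (1 - v) 0| * |(y4 + y5) / 2 - x| ^ 3) * (t ^ 2 * v) ≤
      149 / 100 * h ^ 3 := by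
  obtain ⟨e, he⟩ : ∃ e, y3 - y2 = e := ⟨_, rfl⟩
  rw [he] at ht hu hv k2
  have he0 : 0 < e := by linarith
  have hh0 : 0 ≤ h := by linarith
  have te0 : 0 ≤ t * e := by positivity
  have te1 : t * e ≤ e := mul_le_of_le_one_left he0.le ht1
  have teh : t * e ≤ t * h := by gcongr
  have seh : (1 - t) * e ≤ (1 - t) * h := mul_le_mul_of_nonneg_left k2 (by linarith)
  have eT : |(y2 + y3) / 2 - x| ≤ h * |t - 1 / 2| := by
    rw [show (y2 + y3) / 2 - x = -(e * (t - 1 / 2)) by linarith, abs_neg,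
      abs_mul, abs_of_pos he0]
    gcongr
  have a1 : |(y1 + y2) / 2 - x| = x - (y1 + y2) / 2 := by
    rw [abs_sub_comm, abs_of_nonneg]; linarith
  have a3 : |(y3 + y4) / 2 - x| = (y3 + y4) / 2 - x :=
    abs_of_nonneg (by linarith)
  have a0 : |(y0 + y1) / 2 - x| = x - (y0 + y1) / 2 := by
    rw [abs_sub_comm, abs_of_nonneg]; linarith
  have a4 : |(y4 + y5) / 2 - x| = (y4 + y5) / 2 - x :=
    abs_of_nonneg (by linarith)
  have B0 := outer_le (P := P) (u := u) (h := h) (t := t)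
    (x := |(y0 + y1) / 2 - x|) (y := |(y1 + y2) / 2 - x|)
    (z := |(y2 + y3) / 2 - x|) hP0 hP1 hu0.le hu1 (abs_nonneg _)
    (by rw [a0]; linarith) (abs_nonneg _) (by rw [a1]; linarith) (abs_nonneg _) eT
  have B2 := outer_le (P := R) (u := v) (h := h) (t := 1 - t)
    (x := |(y4 + y5) / 2 - x|)
    (y := |(y3 + y4) / 2 - x|)
    (z := |(y2 + y3) / 2 - x|) hR0 hR1 hv0.le hv1
    (abs_nonneg _) (by rw [a4]; linarith) (abs_nonneg _) (by rw [a3]; linarith) (abs_nonneg _)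
    (by rwa [show 1 - t - 1 / 2 = -(t - 1 / 2) by ring, abs_neg])
  have ut0 : 0 ≤ u * t := mul_nonneg hu0.le ht0
  have vt1 : v * t ≤ v := mul_le_of_le_one_right hv0.le ht1
  have ue := mul_le_mul_of_nonneg_right k2 (show 0 ≤ 1 / 2 + u * (t - 1 / 2) by linarith)
  have ve := mul_le_mul_of_nonneg_right k2 (show 0 ≤ 1 / 2 - v * (t - 1 / 2) by linarith)
  have B1 := inner_le (u := u) (v := v) (h := h) (t := t)
    (x := |(y1 + y2) / 2 - x|)
    (y := |(y2 + y3) / 2 - x|)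
    (z := |(y3 + y4) / 2 - x|) hu0 hu1 hv0 hv1 (abs_nonneg _)
    (by rw [a1]; linarith)
    (by rw [a1]; linear_combination ue - u * ht + hu / 2 - u / 2 * he)
    (abs_nonneg _) eT (abs_nonneg _)
    (by rw [a3]; linarith)
    (by rw [a3]; linear_combination ve + v * ht + v / 2 * he + hv / 2) hh0
  have n0 : 0 ≤ (1 - t) ^ 2 * u := by positivity
  have n1 := middle_coeff_nonneg ht0 ht1 hu1 hv1
  have n2 : 0 ≤ t ^ 2 * v := by positivity
  rw [sub_sub_cancel] at B2
  have B1' := mul_le_mul_of_nonneg_left B1 n1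
  have F := outer_add_outer_add_inner_le ht0 ht1 hu0.le hu1 hv0.le hv1
  have F' := mul_le_mul_of_nonneg_left F (pow_nonneg hh0 3)
  linarith

/-- The quasi-interpolant, at a point, of a function that is cubically small near this point. The
B-splines are nonnegative, so that it suffices to add up the weighted distances. -/
theorem quasiInterpOne_cubic_le (S : KnotSeq m) {p : ℕ} (hp : p ∈ Ico 2 m) {x : ℝ}
    (hx : x ∈ Ico (S.knot p) (S.knot (p + 1))) {h : ℝ}
    (hh : ∀ i < m + 2, S.knot (i + 1) - S.knot i ≤ h) {w : ℝ → ℝ} {K : ℝ} (hK : 0 ≤ K)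
    (hw : ∀ y ∈ Icc (S.knot 2) (S.knot m), |w y| ≤ K * |y - x| ^ 3) :
    |quasiInterpOne S w x| ≤ 149 / 100 * K * h ^ 3 := by
  obtain ⟨q, rfl⟩ : ∃ q, p = q + 2 := ⟨p - 2, by have := hp.1; omega⟩
  have hq : q + 2 < m := hp.2
  obtain ⟨⟨ht0, ht1⟩, ⟨hu0, hu1⟩, ⟨hv0, hv1⟩⟩ := mem_span_coords S hq hx
  have L0 := abs_sum_weight_mul_le S (i := q) (by omega) hw
  have L1 := abs_sum_weight_mul_le S (i := q + 1) (by omega) hw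
  have L2 := abs_sum_weight_mul_le S (i := q + 2) (by omega) hw
  rw [quasiInterpOne, sum_mul_bspline S _ hq hx rfl rfl rfl]
  have g0 := S.le_succ q (by omega)
  have g1 := S.le_succ (q + 1) (by omega)
  have g2 := S.strict (q + 2) (by omega) hq
  have g3 := S.le_succ (q + 3) (by omega)
  have g4 := S.le_succ (q + 4) (by omega)
  have k0 := hh q (by omega)
  have k1 := hh (q + 1) (by omega)
  have k2 := hh (q + 2) (by omega)
  have k3 := hh (q + 3) (by omega)
  have k4 := hh (q + 4) (by omega)
  have P0 := ratio_nonneg g0 g1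
  have P1 := ratio_le_one g0 g1
  have R0 := ratio_nonneg (i := q + 3) g3 g4
  have R1 := ratio_le_one (i := q + 3) g3 g4
  simp only [add_assoc, Nat.reduceAdd] at g0 g1 g2 g3 g4 k0 k1 k2 k3 k4 L0 L1 L2 P0 P1 R0 R1 ⊢
  generalize ∑ k, weight S.knot q k * w (node S.knot q k) = l₀ at *
  generalize ∑ k, weight S.knot (q + 1) k * w (node S.knot (q + 1) k) = l₁ at *
  generalize ∑ k, weight S.knot (q + 2) k * w (node S.knot (q + 2) k) = l₂ at *
  have d1 : S.knot (q + 3) - S.knot (q + 1) ≠ 0 := by linarith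
  have d2 : S.knot (q + 3) - S.knot (q + 2) ≠ 0 := by linarith
  have d3 : S.knot (q + 4) - S.knot (q + 2) ≠ 0 := by linarith
  obtain ⟨t, ht⟩ : ∃ t, (x - S.knot (q + 2)) / (S.knot (q + 3) - S.knot (q + 2)) = t := ⟨_, rfl⟩
  obtain ⟨u, hu⟩ : ∃ u, (S.knot (q + 3) - S.knot (q + 2)) / (S.knot (q + 3) - S.knot (q + 1)) = u :=
    ⟨_, rfl⟩
  obtain ⟨v, hv⟩ : ∃ v, (S.knot (q + 3) - S.knot (q + 2)) / (S.knot (q + 4) - S.knot (q + 2)) = v :=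
    ⟨_, rfl⟩
  rw [ht] at ht0 ht1
  rw [hu] at hu0 hu1
  rw [hv] at hv0 hv1
  rw [ht, hu, hv]
  have ru : ratio S.knot (q + 1) = u := hu
  have rv : ratio S.knot (q + 2) = 1 - v := by
    rw [ratio, ← hv, eq_sub_iff_add_eq, ← add_div]
    simp only [add_assoc, Nat.reduceAdd]
    rw [sub_add_sub_cancel]
    exact div_self d3
  have w0 : weight S.knot q = ratioWeight (ratio S.knot q) (1 - u) := by
    rw [weight_eq_ratioWeight, ru]
  have w1 : weight S.knot (q + 1) = ratioWeight u v := by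
    rw [weight_eq_ratioWeight, ru, rv, sub_sub_cancel]
  have w2 : ∀ k, weight S.knot (q + 2) k = ratioWeight (1 - ratio S.knot (q + 3)) (1 - v) (2 - k) :=
    fun k => by rw [weight_eq_ratioWeight, rv, ratioWeight_swap]
  rw [div_eq_iff d2] at ht
  rw [div_eq_iff d1] at hu
  rw [div_eq_iff d3] at hv
  have M := weighted_distance_sum_le P0 P1 (sub_nonneg.2 R1) (sub_le_self 1 R0) ht0 ht1 hu0 hu1 hv0
    hv1 g0 g1 g2 g3 g4 k0 k1 k2 k3 k4 ht.symm hu.symm hv.symm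
  rw [Fin.sum_univ_three] at L0 L1 L2
  simp only [w0, w1, w2, node, Fin.isValue, Fin.val_zero, Fin.val_one, Fin.val_two, add_zero,
    add_assoc, Nat.reduceAdd] at L0 L1 L2
  rw [show (2 : Fin 3) - 0 = 2 from rfl, show (2 : Fin 3) - 1 = 1 from rfl,
    show (2 : Fin 3) - 2 = 0 from rfl] at L2
  have n0 : 0 ≤ (1 - t) ^ 2 * u := by positivity
  have n1 := middle_coeff_nonneg ht0 ht1 hu1 hv1
  have n2 : 0 ≤ t ^ 2 * v := by positivity
  have M' := mul_le_mul_of_nonneg_left M hK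
  rw [← add_assoc]
  refine le_trans (abs_add_three _ _ _) ?_
  rw [abs_mul l₀, abs_mul l₁, abs_mul l₂, abs_of_nonneg n0, abs_of_nonneg n1, abs_of_nonneg n2]
  have L0' := mul_le_mul_of_nonneg_right L0 n0
  have L1' := mul_le_mul_of_nonneg_right L1 n1
  have L2' := mul_le_mul_of_nonneg_right L2 n2
  clear L0 L1 L2
  linarith

/-- The one-dimensional error bound: at a point where `w` has a quadratic Taylor polynomial with
cubic remainder, the error of the quasi-interpolant is of third order. -/
theorem abs_sub_quasiInterpOne_le (S : KnotSeq m) {p : ℕ} (hp : p ∈ Ico 2 m) {x : ℝ}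
    (hx : x ∈ Ico (S.knot p) (S.knot (p + 1))) {h : ℝ}
    (hh : ∀ i < m + 2, S.knot (i + 1) - S.knot i ≤ h) {w : ℝ → ℝ} {K : ℝ} (hK : 0 ≤ K) {c₁ c₂ : ℝ}
    (hw : ∀ y ∈ Icc (S.knot 2) (S.knot m),
      |w y - (w x + c₁ * (y - x) + c₂ * (y - x) ^ 2)| ≤ K * |y - x| ^ 3) :
    |w x - quasiInterpOne S w x| ≤ 149 / 100 * K * h ^ 3 := by
  have H := quasiInterpOne_cubic_le S hp hx hh hK hw
  obtain ⟨q, rfl⟩ : ∃ q, p = q + 2 := ⟨p - 2, by have := hp.1; omega⟩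
  rwa [quasiInterpOne_sub, quasiInterpOne_quadratic S hp.2 hx, abs_sub_comm] at H

/-! ### Tensor products -/

theorem quasiInterp_eq_quasiInterpOne (S : KnotSeq m) (T : KnotSeq n) (g : ℝ × ℝ → ℝ) (z : ℝ × ℝ) :
    quasiInterp S T g z =
      quasiInterpOne S (fun x => quasiInterpOne T (fun y => g (x, y)) z.2) z.1 := by
  simp only [quasiInterp, quasiInterpOne, coeff, Finset.mul_sum, Finset.sum_mul]
  refine Finset.sum_congr rfl fun i _ => ?_
  rw [Finset.sum_comm]
  refine Finset.sum_congr rfl fun k _ => Finset.sum_congr rfl fun j _ =>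
    Finset.sum_congr rfl fun l _ => ?_
  ring

theorem KnotSeq.exists_span (S : KnotSeq m) {x : ℝ} (hx : x ∈ Ioo (S.knot 2) (S.knot m)) :
    ∃ p ∈ Ico 2 m, x ∈ Ico (S.knot p) (S.knot (p + 1)) := by
  have h3 := S.three_le
  have hex : ∃ j, x < S.knot (j + 1) := ⟨m - 1, by rw [Nat.sub_add_cancel (by omega)]; exact hx.2⟩
  classical
  have hlt := Nat.find_spec hex
  have hmin := fun j (hj : j < Nat.find hex) => not_lt.1 (Nat.find_min hex hj)
  have hle : Nat.find hex ≤ m - 1 := Nat.find_min' hex (by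
    rw [Nat.sub_add_cancel (by omega)]; exact hx.2)
  set p := Nat.find hex
  have h2 : 2 ≤ p := by
    by_contra hc
    have : S.knot (p + 1) ≤ S.knot 2 := S.mono (by omega) (by omega)
    linarith [hx.1]
  refine ⟨p, ⟨h2, by omega⟩, ?_, hlt⟩
  have := hmin (p - 1) (by omega)
  rwa [Nat.sub_add_cancel (by omega)] at this

theorem abs_quasiInterp_le (S : KnotSeq m) (T : KnotSeq n) {g : ℝ × ℝ → ℝ} {K : ℝ}
    (hg : ∀ z ∈ Icc (S.knot 2) (S.knot m) ×ˢ Icc (T.knot 2) (T.knot n), |g z| ≤ K) {z : ℝ × ℝ}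
    (hz : z ∈ paramDomain S T) : |quasiInterp S T g z| ≤ 9 * K := by
  obtain ⟨p, hp, hpz⟩ := S.exists_span hz.1
  obtain ⟨q, hq, hqz⟩ := T.exists_span hz.2
  rw [quasiInterp_eq_quasiInterpOne]
  have := abs_quasiInterpOne_le S hp hpz (K := 3 * K)
    fun x hx => abs_quasiInterpOne_le T hq hqz fun y hy => hg (x, y) ⟨hx, hy⟩
  linarith

theorem quasiInterp_sub (S : KnotSeq m) (T : KnotSeq n) (g g' : ℝ × ℝ → ℝ) (z : ℝ × ℝ) :
    quasiInterp S T (fun w => g w - g' w) z = quasiInterp S T g z - quasiInterp S T g' z := by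
  simp only [quasiInterp_eq_quasiInterpOne, quasiInterpOne_sub]

/-- `F` has, at every point of the set `B` and in both coordinate directions, a quadratic Taylor
polynomial with the remainder bounded by `K` times the third power of the distance. -/
structure HasCubicRemainder (B : Set (ℝ × ℝ)) (K : ℝ) (F : ℝ × ℝ → ℝ) : Prop where
  fst : ∀ x y, (x, y) ∈ B → ∃ c₁ c₂ : ℝ, ∀ x', (x', y) ∈ B →
    |F (x', y) - (F (x, y) + c₁ * (x' - x) + c₂ * (x' - x) ^ 2)| ≤ K * |x' - x| ^ 3
  snd : ∀ x y, (x, y) ∈ B → ∃ c₁ c₂ : ℝ, ∀ y', (x, y') ∈ B →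
    |F (x, y') - (F (x, y) + c₁ * (y' - y) + c₂ * (y' - y) ^ 2)| ≤ K * |y' - y| ^ 3

theorem span_le_stepSize_fst (S : KnotSeq m) (T : KnotSeq n) {i : ℕ} (hi : i < m + 2) :
    S.knot (i + 1) - S.knot i ≤ stepSize S T :=
  (le_ciSup (f := fun i : Fin (m + 2) => S.knot (i + 1) - S.knot i)
    (finite_range _).bddAbove ⟨i, hi⟩).trans (le_max_left _ _)

theorem span_le_stepSize_snd (S : KnotSeq m) (T : KnotSeq n) {j : ℕ} (hj : j < n + 2) :
    T.knot (j + 1) - T.knot j ≤ stepSize S T :=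
  (le_ciSup (f := fun j : Fin (n + 2) => T.knot (j + 1) - T.knot j)
    (finite_range _).bddAbove ⟨j, hj⟩).trans (le_max_right _ _)

/-- The error bound for smooth functions. With the one-dimensional operators `P` and `Q` in the two
directions, the error is `I - P Q = (I - P) + P (I - Q)`, and `P` has norm at most `3`. -/
theorem abs_sub_quasiInterp_le_of_smooth (S : KnotSeq m) (T : KnotSeq n) {F : ℝ × ℝ → ℝ} {K : ℝ}
    (hK : 0 ≤ K)
    (hF : HasCubicRemainder (Icc (S.knot 2) (S.knot m) ×ˢ Icc (T.knot 2) (T.knot n)) K F)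
    {z : ℝ × ℝ} (hz : z ∈ paramDomain S T) :
    |F z - quasiInterp S T F z| ≤ 4 * (149 / 100 * K * stepSize S T ^ 3) := by
  obtain ⟨x, y⟩ := z
  obtain ⟨p, hp, hpz⟩ := S.exists_span hz.1
  obtain ⟨q, hq, hqz⟩ := T.exists_span hz.2
  have hx : x ∈ Icc (S.knot 2) (S.knot m) := Ioo_subset_Icc_self hz.1
  have hy : y ∈ Icc (T.knot 2) (T.knot n) := Ioo_subset_Icc_self hz.2
  have e1 : |F (x, y) - quasiInterpOne S (fun x' => F (x', y)) x| ≤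
      149 / 100 * K * stepSize S T ^ 3 := by
    obtain ⟨c₁, c₂, hc⟩ := hF.fst x y ⟨hx, hy⟩
    exact abs_sub_quasiInterpOne_le (w := fun x' => F (x', y)) S hp hpz
      (fun i hi => span_le_stepSize_fst S T hi) hK (fun x' hx' => hc x' ⟨hx', hy⟩)
  have e2 : ∀ x' ∈ Icc (S.knot 2) (S.knot m),
      |F (x', y) - quasiInterpOne T (fun y' => F (x', y')) y| ≤
        149 / 100 * K * stepSize S T ^ 3 := by
    intro x' hx'
    obtain ⟨c₁, c₂, hc⟩ := hF.snd x' y ⟨hx', hy⟩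
    exact abs_sub_quasiInterpOne_le (w := fun y' => F (x', y')) T hq hqz
      (fun i hi => span_le_stepSize_snd S T hi) hK (fun y' hy' => hc y' ⟨hx', hy'⟩)
  have e3 := abs_quasiInterpOne_le S hp hpz e2
  rw [quasiInterpOne_sub] at e3
  rw [quasiInterp_eq_quasiInterpOne]
  have := abs_sub_le (F (x, y)) (quasiInterpOne S (fun x' => F (x', y)) x)
    (quasiInterpOne S (fun x' => quasiInterpOne T (fun y' => F (x', y')) y) x)
  linarith

/-! ### Directional derivatives, mollification and Taylor's theorem -/

/-- The directional derivative of a function on the plane. -/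
def dirDeriv (e : ℝ × ℝ) (k : ℝ × ℝ → ℝ) (z : ℝ × ℝ) : ℝ := fderiv ℝ k z e

theorem contDiff_dirDeriv (e : ℝ × ℝ) {k : ℝ × ℝ → ℝ} (hk : ContDiff ℝ ((⊤ : ℕ∞) : WithTop ℕ∞) k) :
    ContDiff ℝ ((⊤ : ℕ∞) : WithTop ℕ∞) (dirDeriv e k) :=
  (hk.fderiv_right (m := ((⊤ : ℕ∞) : WithTop ℕ∞)) (by simp)).clm_apply contDiff_const

theorem hasCompactSupport_dirDeriv (e : ℝ × ℝ) {k : ℝ × ℝ → ℝ} (hk : HasCompactSupport k) :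
    HasCompactSupport (dirDeriv e k) :=
  hk.fderiv_apply ℝ e

theorem hasDerivAt_line (e : ℝ × ℝ) {k : ℝ × ℝ → ℝ} (hk : ContDiff ℝ ((⊤ : ℕ∞) : WithTop ℕ∞) k)
    (z : ℝ × ℝ) (t : ℝ) :
    HasDerivAt (fun t : ℝ => k (z + t • e)) (dirDeriv e k (z + t • e)) t := by
  have h1 : HasDerivAt (fun t : ℝ => z + t • e) e t := by
    simpa using ((hasDerivAt_id t).smul_const e).const_add z
  exact ((hk.differentiable (by simp)).differentiableAt.hasFDerivAt.comp_hasDerivAt t h1)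

theorem iteratedDeriv_line (e : ℝ × ℝ) {k : ℝ × ℝ → ℝ}
    (hk : ContDiff ℝ ((⊤ : ℕ∞) : WithTop ℕ∞) k) (z : ℝ × ℝ) (j : ℕ) :
    iteratedDeriv j (fun t : ℝ => k (z + t • e)) = fun t => (dirDeriv e)^[j] k (z + t • e) := by
  induction j generalizing k with
  | zero => simp
  | succ j ih =>
    rw [iteratedDeriv_succ', show deriv (fun t : ℝ => k (z + t • e)) =
      fun t => dirDeriv e k (z + t • e) from funext fun t => (hasDerivAt_line e hk z t).deriv,
      ih (contDiff_dirDeriv e hk)]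
    simp

theorem iterate_dirDeriv_reflect (e z : ℝ × ℝ) {k : ℝ × ℝ → ℝ}
    (hk : ContDiff ℝ ((⊤ : ℕ∞) : WithTop ℕ∞) k) (j : ℕ) (w : ℝ × ℝ) :
    (dirDeriv e)^[j] (fun w => k (z - w)) w = (-1) ^ j * (dirDeriv e)^[j] k (z - w) := by
  have hr : ContDiff ℝ ((⊤ : ℕ∞) : WithTop ℕ∞) (fun w => k (z - w)) :=
    hk.comp (contDiff_const.sub contDiff_id)
  have h1 := congrFun (iteratedDeriv_line e hr w j) 0
  have h2 := congrFun (iteratedDeriv_line e hk (z - w) j) 0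
  have h3 := iteratedDeriv_comp_neg j (fun t : ℝ => k (z - w + t • e)) 0
  simp only [zero_smul, add_zero, neg_zero, smul_eq_mul] at h1 h2 h3
  rw [← h1, ← h2, ← h3]
  congr 1
  funext t
  congr 1
  module

theorem mixedPartial_three_zero {φ : ℝ × ℝ → ℝ} (hφ : ContDiff ℝ ((⊤ : ℕ∞) : WithTop ℕ∞) φ)
    (z : ℝ × ℝ) : mixedPartial 3 0 φ z = (dirDeriv (1, 0))^[3] φ z := by
  have h1 := congrFun (iteratedDeriv_line (1, 0) hφ z 3) 0
  simp only [zero_smul, add_zero] at h1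
  have h2 := congrFun (iteratedDeriv_comp_const_add 3 (fun x => φ (x, z.2)) z.1) 0
  rw [add_zero] at h2
  rw [← h1, mixedPartial]
  simp only [iteratedDeriv_zero]
  rw [← h2]
  congr 1
  funext t
  congr 1
  ext <;> simp

theorem mixedPartial_zero_three {φ : ℝ × ℝ → ℝ} (hφ : ContDiff ℝ ((⊤ : ℕ∞) : WithTop ℕ∞) φ)
    (z : ℝ × ℝ) : mixedPartial 0 3 φ z = (dirDeriv (0, 1))^[3] φ z := by
  have h1 := congrFun (iteratedDeriv_line (0, 1) hφ z 3) 0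
  simp only [zero_smul, add_zero] at h1
  have h2 := congrFun (iteratedDeriv_comp_const_add 3 (fun y => φ (z.1, y)) z.2) 0
  rw [add_zero] at h2
  rw [← h1, mixedPartial, iteratedDeriv_zero, ← h2]
  congr 1
  funext t
  congr 1
  ext <;> simp

/-- The third derivative of `g` in the direction `e` is bounded by `M` on `U` in the sense of
distributions. -/
def WeakThirdDerivBound (U : Set (ℝ × ℝ)) (e : ℝ × ℝ) (M : ℝ) (g : ℝ × ℝ → ℝ) : Prop :=
  ∀ φ : ℝ × ℝ → ℝ, ContDiff ℝ ((⊤ : ℕ∞) : WithTop ℕ∞) φ → HasCompactSupport φ → tsupport φ ⊆ U →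
    |∫ z in U, g z * (dirDeriv e)^[3] φ z| ≤ M * ∫ z in U, |φ z|

/-- The mollification of the restriction of `g` to `U` by the kernel `k`. -/
def mollify (U : Set (ℝ × ℝ)) (g k : ℝ × ℝ → ℝ) : ℝ × ℝ → ℝ :=
  MeasureTheory.convolution (U.indicator g) k (ContinuousLinearMap.mul ℝ ℝ) volume

section Mollify

variable {U : Set (ℝ × ℝ)} {g k : ℝ × ℝ → ℝ}

theorem contDiff_mollify (hg : LocallyIntegrable (U.indicator g))
    (hk : ContDiff ℝ ((⊤ : ℕ∞) : WithTop ℕ∞) k) (hc : HasCompactSupport k) :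
    ContDiff ℝ ((⊤ : ℕ∞) : WithTop ℕ∞) (mollify U g k) :=
  hc.contDiff_convolution_right _ hg hk

theorem dirDeriv_mollify (e : ℝ × ℝ) (hg : LocallyIntegrable (U.indicator g))
    (hk : ContDiff ℝ ((⊤ : ℕ∞) : WithTop ℕ∞) k) (hc : HasCompactSupport k) :
    dirDeriv e (mollify U g k) = mollify U g (dirDeriv e k) := by
  funext z
  have hk1 : ContDiff ℝ 1 k := hk.of_le (by exact_mod_cast le_top)
  have h := hc.hasFDerivAt_convolution_right (ContinuousLinearMap.mul ℝ ℝ) hg hk1 z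
  rw [dirDeriv, mollify, h.fderiv]
  exact convolution_precompR_apply _ hg (hc.fderiv ℝ) (hk1.continuous_fderiv one_ne_zero) z e

theorem iterate_dirDeriv_mollify (e : ℝ × ℝ) (hg : LocallyIntegrable (U.indicator g))
    (hk : ContDiff ℝ ((⊤ : ℕ∞) : WithTop ℕ∞) k) (hc : HasCompactSupport k) (j : ℕ) :
    (dirDeriv e)^[j] (mollify U g k) = mollify U g ((dirDeriv e)^[j] k) := by
  induction j generalizing k with
  | zero => rfl
  | succ j ih =>
    rw [Function.iterate_succ_apply, dirDeriv_mollify e hg hk hc,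
      ih (contDiff_dirDeriv e hk) (hasCompactSupport_dirDeriv e hc), Function.iterate_succ_apply]

/-- A distributional bound of the third derivative is a pointwise bound for the mollification. -/
theorem abs_iterate_dirDeriv_mollify_le (hU : MeasurableSet U)
    (hg : LocallyIntegrable (U.indicator g)) (hk : ContDiff ℝ ((⊤ : ℕ∞) : WithTop ℕ∞) k)
    (hc : HasCompactSupport k) (hk0 : ∀ z, 0 ≤ k z) (hk1 : ∫ z, k z = 1) {r : ℝ}
    (hr : tsupport k ⊆ Metric.closedBall 0 r) {e : ℝ × ℝ} {M : ℝ} (hM : 0 ≤ M)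
    (hw : WeakThirdDerivBound U e M g) {z : ℝ × ℝ} (hz : Metric.closedBall z r ⊆ U) :
    |(dirDeriv e)^[3] (mollify U g k) z| ≤ M := by
  have hs : tsupport (fun w => k (z - w)) ⊆ Metric.closedBall z r := by
    refine closure_minimal (fun w hw' => ?_) Metric.isClosed_closedBall
    have := hr (subset_tsupport k hw')
    rwa [mem_closedBall_zero_iff, ← dist_eq_norm, dist_comm] at this
  have hφ : ContDiff ℝ ((⊤ : ℕ∞) : WithTop ℕ∞) (fun w => k (z - w)) :=
    hk.comp (contDiff_const.sub contDiff_id)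
  have hφc : HasCompactSupport (fun w => k (z - w)) :=
    HasCompactSupport.of_support_subset_isCompact (isCompact_closedBall z r)
      ((subset_tsupport _).trans hs)
  have H := hw _ hφ hφc (hs.trans hz)
  have e1 : ∫ w in U, g w * (dirDeriv e)^[3] (fun w => k (z - w)) w =
      -(dirDeriv e)^[3] (mollify U g k) z := by
    rw [iterate_dirDeriv_mollify e hg hk hc, mollify, convolution_def, ← integral_indicator hU,
      ← integral_neg]
    congr 1
    funext w
    by_cases hwU : w ∈ U
    · rw [indicator_of_mem hwU, indicator_of_mem hwU, iterate_dirDeriv_reflect e z hk,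
        ContinuousLinearMap.mul_apply']
      ring
    · rw [indicator_of_notMem hwU, indicator_of_notMem hwU, map_zero, zero_apply,
        neg_zero]
  have e2 : ∫ w in U, |k (z - w)| ≤ 1 := by
    calc ∫ w in U, |k (z - w)| = ∫ w in U, k (z - w) := by simp_rw [abs_of_nonneg (hk0 _)]
      _ ≤ ∫ w, k (z - w) := setIntegral_le_integral
          (hφ.continuous.integrable_of_hasCompactSupport hφc) (.of_forall fun w => hk0 _)
      _ = 1 := by rw [integral_sub_left_eq_self, hk1]
  rw [e1, abs_neg] at H
  exact H.trans (mul_le_of_le_one_right hM e2)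

end Mollify

/-- Taylor's theorem along a line. -/
theorem abs_sub_taylor_le (e : ℝ × ℝ) {G : ℝ × ℝ → ℝ} (hG : ContDiff ℝ ((⊤ : ℕ∞) : WithTop ℕ∞) G)
    (z : ℝ × ℝ) {M t : ℝ} (hM : ∀ s ∈ uIcc 0 t, |(dirDeriv e)^[3] G (z + s • e)| ≤ M) :
    |G (z + t • e) - (G z + dirDeriv e G z * t + (dirDeriv e)^[2] G z / 2 * t ^ 2)| ≤
      M / 6 * |t| ^ 3 := by
  rcases eq_or_ne 0 t with rfl | ht
  · simp
  have hl : ContDiff ℝ ((⊤ : ℕ∞) : WithTop ℕ∞) (fun t : ℝ => G (z + t • e)) :=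
    hG.comp (contDiff_const.add (contDiff_id.smul contDiff_const))
  obtain ⟨s, hs, h⟩ := taylor_mean_remainder_lagrange_iteratedDeriv (n := 2) ht
    (by exact_mod_cast (contDiff_infty.1 hl (2 + 1)).contDiffOn)
  have hit : ∀ j : ℕ, iteratedDerivWithin j (fun t : ℝ => G (z + t • e)) (uIcc 0 t) 0 =
      (dirDeriv e)^[j] G z := fun j => by
    rw [iteratedDerivWithin_eq_iteratedDeriv (uniqueDiffOn_uIcc ht)
      (contDiff_infty.1 hl j).contDiffAt left_mem_uIcc, iteratedDeriv_line e hG]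
    simp
  rw [taylorWithinEval_succ, taylorWithinEval_succ, taylor_within_zero_eval, hit, hit,
    iteratedDeriv_line e hG] at h
  have hb := hM s (Ioo_subset_Icc_self hs)
  have e1 : G (z + t • e) - (G z + dirDeriv e G z * t + (dirDeriv e)^[2] G z / 2 * t ^ 2) =
      (dirDeriv e)^[3] G (z + s • e) * t ^ 3 / 6 := by
    norm_num [Nat.factorial] at h
    rw [Function.iterate_succ_apply, Function.iterate_succ_apply, Function.iterate_succ_apply]
    rw [Function.iterate_succ_apply, Function.iterate_succ_apply]
    simp only [Function.iterate_zero, id]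
    linarith
  rw [e1, abs_div, abs_mul, abs_pow, abs_of_pos (by norm_num : (0 : ℝ) < 6)]
  have := mul_le_mul_of_nonneg_right hb (show 0 ≤ |t| ^ 3 by positivity)
  linarith

/-! ### Bounds from the Sobolev norm -/

theorem IsWeakDeriv.abs_integral_le {U : Set (ℝ × ℝ)} {a b : ℕ} {f d : ℝ × ℝ → ℝ}
    (h : IsWeakDeriv U a b f d) {M : ℝ} (hM : 0 ≤ M)
    (hd : eLpNorm d ∞ (volume.restrict U) ≤ ENNReal.ofReal M) {φ : ℝ × ℝ → ℝ}
    (hφ : ContDiff ℝ ((⊤ : ℕ∞) : WithTop ℕ∞) φ) (hc : HasCompactSupport φ) (hs : tsupport φ ⊆ U) :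
    |∫ z in U, f z * mixedPartial a b φ z| ≤ M * ∫ z in U, |φ z| := by
  rw [h.2.2 φ hφ hc hs, abs_mul, abs_pow, abs_neg, abs_one, one_pow, one_mul,
    ← integral_const_mul, ← Real.norm_eq_abs]
  refine norm_integral_le_of_norm_le
    ((hφ.continuous.integrable_of_hasCompactSupport hc).abs.restrict.const_mul M) ?_
  rw [eLpNorm_exponent_top] at hd
  filter_upwards [ae_le_eLpNormEssSup (f := d) (μ := volume.restrict U)] with z hz
  rw [norm_mul, Real.norm_eq_abs (φ z)]
  refine mul_le_mul_of_nonneg_right ?_ (abs_nonneg _)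
  have := hz.trans hd
  rwa [← ofReal_norm, ENNReal.ofReal_le_ofReal_iff hM] at this

theorem abs_integral_mixedPartial_le {U : Set (ℝ × ℝ)} {a b : ℕ} {f : ℝ × ℝ → ℝ} {M : ℝ}
    (hM : 0 ≤ M) (h : weakDerivNorm U a b f ≤ ENNReal.ofReal M) {φ : ℝ × ℝ → ℝ}
    (hφ : ContDiff ℝ ((⊤ : ℕ∞) : WithTop ℕ∞) φ) (hc : HasCompactSupport φ) (hs : tsupport φ ⊆ U) :
    |∫ z in U, f z * mixedPartial a b φ z| ≤ M * ∫ z in U, |φ z| := by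
  have key : ∀ ε > 0, |∫ z in U, f z * mixedPartial a b φ z| ≤ (M + ε) * ∫ z in U, |φ z| := by
    intro ε hε
    have hlt : weakDerivNorm U a b f < ENNReal.ofReal (M + ε) :=
      h.trans_lt ((ENNReal.ofReal_lt_ofReal_iff (by linarith)).2 (by linarith))
    rw [weakDerivNorm, iInf_lt_iff] at hlt
    obtain ⟨d, hd⟩ := hlt
    obtain ⟨hw, hd⟩ := iInf_lt_iff.1 hd
    exact hw.abs_integral_le (by linarith) hd.le hφ hc hs
  have ht : Filter.Tendsto (fun ε : ℝ => (M + ε) * ∫ z in U, |φ z|) (nhdsWithin 0 (Ioi 0))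
      (nhds (M * ∫ z in U, |φ z|)) := by
    have : Continuous fun ε : ℝ => (M + ε) * ∫ z in U, |φ z| := by fun_prop
    have h0 := this.tendsto 0
    rw [add_zero] at h0
    exact h0.mono_left nhdsWithin_le_nhds
  exact ge_of_tendsto ht (Filter.eventually_of_mem self_mem_nhdsWithin key)

/-- Only the two pure third derivatives are needed. -/
theorem weakThirdDerivBound_of_sobolevNorm_le {U : Set (ℝ × ℝ)} {g : ℝ × ℝ → ℝ} {M : ℝ}
    (hM : 0 ≤ M) (h : sobolevNorm 3 U g ≤ ENNReal.ofReal M) :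
    WeakThirdDerivBound U (1, 0) M g ∧ WeakThirdDerivBound U (0, 1) M g := by
  have hle : ∀ a b, a + b ≤ 3 → weakDerivNorm U a b g ≤ ENNReal.ofReal M := fun a b hab =>
    (le_iSup₂_of_le (f := fun a b => ⨆ (_ : a + b ≤ 3), weakDerivNorm U a b g) a b
      (le_iSup (fun _ : a + b ≤ 3 => weakDerivNorm U a b g) hab)).trans h
  constructor
  · intro φ hφ hc hs
    simp_rw [← mixedPartial_three_zero hφ]
    exact abs_integral_mixedPartial_le hM (hle 3 0 (by norm_num)) hφ hc hs
  · intro φ hφ hc hs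
    simp_rw [← mixedPartial_zero_three hφ]
    exact abs_integral_mixedPartial_le hM (hle 0 3 (by norm_num)) hφ hc hs

/-! ### Smooth approximation on a rectangle -/

/-- Approximation by smooth functions up to the boundary of a rectangle: `g` is mollified in the
interior, and the mollification is composed with a contraction `A` of the closed rectangle into the
interior, which does not increase derivatives. -/
theorem exists_smooth_approx {a b c d : ℝ} (hab : a < b) (hcd : c < d) {g : ℝ × ℝ → ℝ}
    (hg : ContinuousOn g (Icc a b ×ˢ Icc c d)) {M : ℝ} (hM : 0 ≤ M)
    (hx : WeakThirdDerivBound (Ioo a b ×ˢ Ioo c d) (1, 0) M g)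
    (hy : WeakThirdDerivBound (Ioo a b ×ˢ Ioo c d) (0, 1) M g) {ε : ℝ} (hε : 0 < ε) :
    ∃ F : ℝ × ℝ → ℝ, (∀ z ∈ Icc a b ×ˢ Icc c d, |F z - g z| ≤ ε) ∧
      HasCubicRemainder (Icc a b ×ˢ Icc c d) (M / 6) F := by
  set U : Set (ℝ × ℝ) := Ioo a b ×ˢ Ioo c d with hU
  have hUm : MeasurableSet U := measurableSet_Ioo.prod measurableSet_Ioo
  have hcomp : IsCompact (Icc a b ×ˢ Icc c d) := isCompact_Icc.prod isCompact_Icc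
  have hUK : U ⊆ Icc a b ×ˢ Icc c d := prod_mono Ioo_subset_Icc_self Ioo_subset_Icc_self
  have hint : Integrable (U.indicator g) :=
    (integrable_indicator_iff hUm).2 ((hg.integrableOn_compact hcomp).mono_set hUK)
  obtain ⟨η, hη, hunif⟩ := Metric.uniformContinuousOn_iff.1
    (hcomp.uniformContinuousOn_of_continuous hg) (ε / 2) (by positivity)
  obtain ⟨δ, hδ0, hδ1, hδη⟩ : ∃ δ : ℝ, 0 < δ ∧ δ < 1 ∧ δ * ((b - a) + (d - c)) < η := by
    have hR : 0 < (b - a) + (d - c) := by linarith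
    refine ⟨min (1 / 2) (η / (2 * ((b - a) + (d - c)))), lt_min (by norm_num) (by positivity),
      (min_le_left _ _).trans_lt (by norm_num), ?_⟩
    calc min (1 / 2) (η / (2 * ((b - a) + (d - c)))) * ((b - a) + (d - c))
        ≤ η / (2 * ((b - a) + (d - c))) * ((b - a) + (d - c)) := by gcongr; exact min_le_right _ _
      _ = η / 2 := by field_simp
      _ < η := by linarith
  have hδa : 0 < δ * (b - a) := mul_pos hδ0 (by linarith)
  have hδc : 0 < δ * (d - c) := mul_pos hδ0 (by linarith)
  obtain ⟨r, hr0, hrη, hra, hrc⟩ : ∃ r : ℝ, 0 < r ∧ r < η ∧ r < δ * (b - a) / 2 ∧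
      r < δ * (d - c) / 2 := by
    obtain ⟨r, hr0, hr⟩ := exists_between
      (lt_min hη (lt_min (half_pos hδa) (half_pos hδc)))
    exact ⟨r, hr0, hr.trans_le (min_le_left _ _),
      hr.trans_le ((min_le_right _ _).trans (min_le_left _ _)),
      hr.trans_le ((min_le_right _ _).trans (min_le_right _ _))⟩
  let A : ℝ × ℝ → ℝ × ℝ := fun z =>
    (z.1 + δ * ((a + b) / 2 - z.1), z.2 + δ * ((c + d) / 2 - z.2))
  -- `V` is the image of the rectangle under the contraction `A`
  set V : Set (ℝ × ℝ) := Icc (a + δ * (b - a) / 2) (b - δ * (b - a) / 2) ×ˢ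
    Icc (c + δ * (d - c) / 2) (d - δ * (d - c) / 2) with hV
  -- one coordinate of the inclusion `hAV`
  have shrink : ∀ {p q x : ℝ}, x ∈ Icc p q →
      x + δ * ((p + q) / 2 - x) ∈ Icc (p + δ * (q - p) / 2) (q - δ * (q - p) / 2) := by
    rintro p q x ⟨h1, h2⟩
    have e1 := mul_nonneg (sub_pos.2 hδ1).le (sub_nonneg.2 h1)
    have e2 := mul_nonneg (sub_pos.2 hδ1).le (sub_nonneg.2 h2)
    constructor <;> linarith
  have hAV : ∀ z ∈ Icc a b ×ˢ Icc c d, A z ∈ V := fun z hz => ⟨shrink hz.1, shrink hz.2⟩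
  have hball : ∀ z ∈ V, Metric.closedBall z r ⊆ U := by
    rintro ⟨x, y⟩ ⟨⟨h1, h2⟩, h3, h4⟩
    rw [← closedBall_prod_same, Real.closedBall_eq_Icc, Real.closedBall_eq_Icc]
    simp only at h1 h2 h3 h4
    exact prod_mono (Icc_subset_Ioo (by linarith) (by linarith))
      (Icc_subset_Ioo (by linarith) (by linarith))
  let κ : ContDiffBump (0 : ℝ × ℝ) := ⟨r / 2, r, half_pos hr0, half_lt_self hr0⟩
  have hk : ContDiff ℝ ((⊤ : ℕ∞) : WithTop ℕ∞) (κ.normed volume) := κ.contDiff_normed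
  have hkc : HasCompactSupport (κ.normed volume) := κ.hasCompactSupport_normed
  have hkr : tsupport (κ.normed volume) ⊆ Metric.closedBall 0 r := κ.tsupport_normed_eq.subset
  set G := mollify U g (κ.normed volume) with hG
  have hGs : ContDiff ℝ ((⊤ : ℕ∞) : WithTop ℕ∞) G := contDiff_mollify hint.locallyIntegrable hk hkc
  have hD : ∀ {e : ℝ × ℝ}, WeakThirdDerivBound U e M g → ∀ z ∈ V, |(dirDeriv e)^[3] G z| ≤ M :=
    fun he z hz => abs_iterate_dirDeriv_mollify_le hUm hint.locallyIntegrable hk hkc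
      κ.nonneg_normed κ.integral_normed hkr hM he (hball z hz)
  have hGg : ∀ z ∈ V, |G z - g z| ≤ ε / 2 := by
    intro z hz
    have hzU : z ∈ U := hball z hz (Metric.mem_closedBall_self hr0.le)
    have h := κ.dist_normed_convolution_le (μ := volume) (x₀ := z) (ε := ε / 2)
      hint.aestronglyMeasurable fun w hw => by
        have hwU : w ∈ U := hball z hz (Metric.ball_subset_closedBall hw)
        rw [indicator_of_mem hwU, indicator_of_mem hzU]
        exact (hunif w (hUK hwU) z (hUK hzU) ((Metric.mem_ball.1 hw).trans hrη)).le
    rw [convolution_lsmul_swap, indicator_of_mem hzU, Real.dist_eq] at h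
    rw [hG, mollify, convolution_def]
    simpa only [smul_eq_mul, ContinuousLinearMap.mul_apply', mul_comm] using h
  refine ⟨fun z => G (A z), fun z hz => ?_, ⟨fun x y hxy => ?_, fun x y hxy => ?_⟩⟩
  · have hdist : dist (A z) z < η := by
      have h1 : |δ * ((a + b) / 2 - z.1)| ≤ δ * (b - a) := by
        rw [abs_mul, abs_of_pos hδ0]
        have : |(a + b) / 2 - z.1| ≤ b - a :=
          abs_le.2 ⟨by linarith [hz.1.2], by linarith [hz.1.1]⟩
        gcongr
      have h2 : |δ * ((c + d) / 2 - z.2)| ≤ δ * (d - c) := by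
        rw [abs_mul, abs_of_pos hδ0]
        have : |(c + d) / 2 - z.2| ≤ d - c :=
          abs_le.2 ⟨by linarith [hz.2.2], by linarith [hz.2.1]⟩
        gcongr
      rw [Prod.dist_eq, Real.dist_eq, Real.dist_eq, add_sub_cancel_left, add_sub_cancel_left]
      exact max_lt (by linarith) (by linarith)
    have h1 := hGg _ (hAV z hz)
    have h2 := (hunif _ (hUK (hball _ (hAV z hz) (Metric.mem_closedBall_self hr0.le))) z hz hdist)
    rw [Real.dist_eq] at h2
    have h3 := abs_sub_le (G (A z)) (g (A z)) (g z)
    linarith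
  · refine ⟨(1 - δ) * dirDeriv (1, 0) G (A (x, y)),
      (1 - δ) ^ 2 * ((dirDeriv (1, 0))^[2] G (A (x, y)) / 2), fun x' hx' => ?_⟩
    have v1 := hAV _ hxy
    have v2 := hAV _ hx'
    have hline : A (x', y) = A (x, y) + ((1 - δ) * (x' - x)) • ((1 : ℝ), (0 : ℝ)) := by
      ext <;> simp [A]
      ring
    have ht := abs_sub_taylor_le (1, 0) hGs (A (x, y)) (M := M) (t := (1 - δ) * (x' - x))
      fun s hs => hD hx _ (by
        rw [hline] at v2
        obtain ⟨⟨p1, p2⟩, p3⟩ := v1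
        obtain ⟨⟨q1, q2⟩, -⟩ := v2
        simp only [Prod.fst_add, Prod.smul_fst, smul_eq_mul, mul_one] at q1 q2
        refine ⟨?_, by simpa using p3⟩
        simp only [Prod.fst_add, Prod.smul_fst, smul_eq_mul, mul_one]
        rcases mem_uIcc.1 hs with ⟨s1, s2⟩ | ⟨s1, s2⟩ <;> constructor <;> linarith)
    rw [← hline, abs_mul, abs_of_pos (sub_pos.2 hδ1)] at ht
    have hle : ((1 - δ) * |x' - x|) ^ 3 ≤ |x' - x| ^ 3 := by
      gcongr
      exact mul_le_of_le_one_left (abs_nonneg _) (by linarith)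
    have := mul_le_mul_of_nonneg_left hle (show 0 ≤ M / 6 by positivity)
    refine le_trans (le_of_eq ?_) (ht.trans this)
    congr 1
    ring
  · refine ⟨(1 - δ) * dirDeriv (0, 1) G (A (x, y)),
      (1 - δ) ^ 2 * ((dirDeriv (0, 1))^[2] G (A (x, y)) / 2), fun y' hy' => ?_⟩
    have v1 := hAV _ hxy
    have v2 := hAV _ hy'
    have hline : A (x, y') = A (x, y) + ((1 - δ) * (y' - y)) • ((0 : ℝ), (1 : ℝ)) := by
      ext <;> simp [A]
      ring
    have ht := abs_sub_taylor_le (0, 1) hGs (A (x, y)) (M := M) (t := (1 - δ) * (y' - y))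
      fun s hs => hD hy _ (by
        rw [hline] at v2
        obtain ⟨p3, p1, p2⟩ := v1
        obtain ⟨-, q1, q2⟩ := v2
        simp only [Prod.snd_add, Prod.smul_snd, smul_eq_mul, mul_one] at q1 q2
        refine ⟨by simpa using p3, ?_⟩
        simp only [Prod.snd_add, Prod.smul_snd, smul_eq_mul, mul_one]
        rcases mem_uIcc.1 hs with ⟨s1, s2⟩ | ⟨s1, s2⟩ <;> constructor <;> linarith)
    rw [← hline, abs_mul, abs_of_pos (sub_pos.2 hδ1)] at ht
    have hle : ((1 - δ) * |y' - y|) ^ 3 ≤ |y' - y| ^ 3 := by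
      gcongr
      exact mul_le_of_le_one_left (abs_nonneg _) (by linarith)
    have := mul_le_mul_of_nonneg_left hle (show 0 ≤ M / 6 by positivity)
    refine le_trans (le_of_eq ?_) (ht.trans this)
    congr 1
    ring

/-! ### The error of the quasi-interpolant -/

theorem KnotSeq.two_lt (S : KnotSeq m) : S.knot 2 < S.knot m :=
  (S.strict 2 le_rfl (by have := S.three_le; omega)).trans_le
    (S.mono (by have := S.three_le; omega) (by omega))

theorem closure_paramDomain (S : KnotSeq m) (T : KnotSeq n) :
    closure (paramDomain S T) = Icc (S.knot 2) (S.knot m) ×ˢ Icc (T.knot 2) (T.knot n) := by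
  rw [paramDomain, closure_prod_eq, closure_Ioo S.two_lt.ne, closure_Ioo T.two_lt.ne]

/-- The error bound of the quasi-interpolant for functions in `W^{3,∞}`. -/
theorem abs_sub_quasiInterp_le (S : KnotSeq m) (T : KnotSeq n) {g : ℝ × ℝ → ℝ}
    (hg : ContinuousOn g (closure (paramDomain S T))) {M : ℝ} (hM : 0 ≤ M)
    (h : sobolevNorm 3 (paramDomain S T) g ≤ ENNReal.ofReal M) {z : ℝ × ℝ}
    (hz : z ∈ paramDomain S T) :
    |g z - quasiInterp S T g z| ≤ 149 / 150 * M * stepSize S T ^ 3 := by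
  rw [closure_paramDomain] at hg
  obtain ⟨hx, hy⟩ := weakThirdDerivBound_of_sobolevNorm_le hM h
  refine le_of_forall_pos_le_add fun ε hε => ?_
  obtain ⟨F, hFg, hF⟩ := exists_smooth_approx S.two_lt T.two_lt hg hM hx hy
    (show 0 < ε / 10 by positivity)
  have h1 := abs_sub_quasiInterp_le_of_smooth S T (by positivity) hF hz
  have h2 := abs_quasiInterp_le S T hFg hz
  have h3 := hFg z (closure_paramDomain S T ▸ subset_closure hz)
  rw [quasiInterp_sub] at h2
  rw [abs_sub_comm] at h3
  have h4 := abs_sub_le (g z) (F z) (quasiInterp S T g z)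
  have h5 := abs_sub_le (F z) (quasiInterp S T F z) (quasiInterp S T g z)
  linarith

/-! ### The two sides of the interface -/

/-- An element that does not meet `Ω₀` lies on the side of `Ω₁`. -/
theorem box_subset_closure_one (S : KnotSeq m) (T : KnotSeq n) {Ω₀ Ω₁ : Set (ℝ × ℝ)}
    (hΩ : IsDivision (paramDomain S T) Ω₀ Ω₁) {e : ℕ × ℕ} (he : e ∈ elementIdx m n)
    (h0 : ¬ (box S T e ∩ Ω₀).Nonempty) : box S T e ⊆ closure Ω₁ := by
  set O : Set (ℝ × ℝ) :=
    Ioo (S.knot e.1) (S.knot (e.1 + 1)) ×ˢ Ioo (T.knot e.2) (T.knot (e.2 + 1)) with hO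
  have hOb : O ⊆ box S T e := prod_mono Ioo_subset_Icc_self Ioo_subset_Icc_self
  have hcl : closure O = box S T e := by
    rw [hO, closure_prod_eq, closure_Ioo (S.strict _ he.1.1 he.1.2).ne,
      closure_Ioo (T.strict _ he.2.1 he.2.2).ne, box]
  have hdis : Disjoint O (closure Ω₀) :=
    (Set.disjoint_left.2 fun z hz hz0 => h0 ⟨z, hOb hz, hz0⟩).closure_right
      (isOpen_Ioo.prod isOpen_Ioo)
  rw [← hcl]
  refine closure_minimal (fun z hz => ?_) isClosed_closure
  rcases hΩ.cover.subset (box_subset_closure S T he (hOb hz)) with h | h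
  · exact absurd h (Set.disjoint_left.1 hdis hz)
  · exact h

theorem measurableSet_enrichedRegion (S : KnotSeq m) (T : KnotSeq n) (Ω₀ Ω₁ : Set (ℝ × ℝ)) :
    MeasurableSet (enrichedRegion S T Ω₀ Ω₁) :=
  MeasurableSet.biUnion (to_countable _) fun _ _ => measurableSet_Icc.prod measurableSet_Icc

/-- An extension agrees with the original function on the closure of its part of the domain. -/
theorem IsExtension.eqOn_closure {Ω Ω' : Set (ℝ × ℝ)} {E : ℝ≥0} {f g : ℝ × ℝ → ℝ}
    (h : IsExtension Ω Ω' E f g) (hf : ContinuousOn f (closure Ω))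
    (hsub : closure Ω' ⊆ closure Ω) : EqOn f g (closure Ω') :=
  h.eqOn.symm.of_subset_closure (hf.mono hsub) (h.continuousOn.mono hsub) subset_closure
    Subset.rfl

end SplineInterface

end

open SplineInterface in
theorem mainTheorem2 :
    ∃ C : ℝ, 0 < C ∧ C < 1 ∧
      ∀ (m n : ℕ) (S : KnotSeq m) (T : KnotSeq n) (Ω₀ Ω₁ : Set (ℝ × ℝ)),
        IsDivision (paramDomain S T) Ω₀ Ω₁ →
      ∀ (E : ℝ≥0) (f g₀ g₁ : ℝ × ℝ → ℝ),
        ContinuousOn f (closure (paramDomain S T)) →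
        MemSobolev 3 Ω₀ f → MemSobolev 3 Ω₁ f →
        IsExtension (paramDomain S T) Ω₀ E f g₀ →
        IsExtension (paramDomain S T) Ω₁ E f g₁ →
        eLpNorm (fun z => f z - modQuasiInterp S T Ω₀ Ω₁ g₀ g₁ z) ∞
            (volume.restrict (paramDomain S T \ enrichedRegion S T Ω₀ Ω₁)) ≤
          ENNReal.ofReal (C * E * stepSize S T ^ 3) *
            max (sobolevNorm 3 Ω₀ f) (sobolevNorm 3 Ω₁ f) := by
  refine ⟨149 / 150, by norm_num, by norm_num, ?_⟩
  intro m n S T Ω₀ Ω₁ hΩ E f g₀ g₁ hf hf0 hf1 hg0 hg1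
  have hfin : max (sobolevNorm 3 Ω₀ f) (sobolevNorm 3 Ω₁ f) ≠ ∞ := (max_lt hf0 hf1).ne
  obtain ⟨N, hN0, hN⟩ : ∃ N : ℝ, 0 ≤ N ∧
      max (sobolevNorm 3 Ω₀ f) (sobolevNorm 3 Ω₁ f) = ENNReal.ofReal N :=
    ⟨_, ENNReal.toReal_nonneg, (ENNReal.ofReal_toReal hfin).symm⟩
  have hEN : (E : ℝ≥0∞) * ENNReal.ofReal N = ENNReal.ofReal (E * N) := by
    rw [ENNReal.ofReal_mul E.coe_nonneg, ENNReal.ofReal_coe_nnreal]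
  have hM : 0 ≤ (E : ℝ) * N := mul_nonneg E.coe_nonneg hN0
  have b0 : sobolevNorm 3 (paramDomain S T) g₀ ≤ ENNReal.ofReal (E * N) := by
    rw [← hEN, ← hN]
    exact hg0.bound.trans (by gcongr; exact le_max_left _ _)
  have b1 : sobolevNorm 3 (paramDomain S T) g₁ ≤ ENNReal.ofReal (E * N) := by
    rw [← hEN, ← hN]
    exact hg1.bound.trans (by gcongr; exact le_max_right _ _)
  have eq0 := hg0.eqOn_closure hf (subset_union_left.trans hΩ.cover.superset)
  have eq1 := hg1.eqOn_closure hf (subset_union_right.trans hΩ.cover.superset)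
  have hh : 0 ≤ stepSize S T :=
    (sub_nonneg.2 (S.le_succ 0 (by omega))).trans (span_le_stepSize_fst S T (by omega))
  rw [hN, ← ENNReal.ofReal_mul (by positivity), eLpNorm_exponent_top]
  refine eLpNormEssSup_le_of_ae_bound ?_
  refine ae_restrict_of_forall_mem ((measurableSet_Ioo.prod measurableSet_Ioo).diff
    (measurableSet_enrichedRegion S T Ω₀ Ω₁)) ?_
  rintro z ⟨hz, hzE⟩
  obtain ⟨p, hp, hpz⟩ := S.exists_span hz.1
  obtain ⟨q, hq, hqz⟩ := T.exists_span hz.2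
  have he : (p, q) ∈ elementIdx m n := ⟨hp, hq⟩
  have hzb : z ∈ box S T (p, q) := ⟨Ico_subset_Icc_self hpz, Ico_subset_Icc_self hqz⟩
  rw [Real.norm_eq_abs, show (149 / 150 * (E : ℝ) * stepSize S T ^ 3 * N) =
    149 / 150 * (E * N) * stepSize S T ^ 3 by ring]
  -- `(p, q)` is the element of the mesh that contains `z`
  by_cases h0 : (box S T (p, q) ∩ Ω₀).Nonempty
  · have heJ : (p, q) ∉ nearIdxPlus S T Ω₀ Ω₁ 1 := fun h =>
      hzE (mem_biUnion (t := fun e => box S T e) h hzb)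
    have hΓ : ¬ (box S T (p, q) ∩ interface Ω₀ Ω₁).Nonempty := fun h =>
      heJ ⟨⟨he, Or.inl ⟨he, h⟩⟩, h0⟩
    have hz0 : z ∈ closure Ω₀ := box_subset_side S T hΩ he hΓ
      (h0.mono (inter_subset_inter_right _ subset_closure)) hzb
    rw [modQuasiInterp_eq_zero S T hΩ g₀ g₁ he h0 heJ hpz hqz, eq0 hz0]
    exact abs_sub_quasiInterp_le S T hg0.continuousOn hM b0 hz
  · have hsub := box_subset_closure_one S T hΩ he h0
    rw [modQuasiInterp_eq_one S T g₀ g₁ he hsub hpz hqz, eq1 (hsub hzb)]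
    exact abs_sub_quasiInterp_le S T hg1.continuousOn hM b1 hz
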